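/- \textbf{Theorem.} Let $(\xi,A,B,\eta)$ consist of arrays with nonnegative real entries in block form $$\xi'=(\xi_1',\xi_2'),\quad A=\begin{pmatrix}A_1&A_0\\0&A_2\end{pmatrix},\quad B=\begin{pmatrix}B_1&B_0\\0&B_2\end{pmatrix},\quad \eta=\begin{pmatrix}\eta_1\\ \eta_2\end{pmatrix},$$ where $\xi_j,\eta_j$ are column vectors of size $m_j$, $A_j,B_j$ are $m_j\times m_j$ matrices ($j=1,2$) and $A_0,B_0$ are $m_1\times m_2$ matrices. Let $\mu$ be the monoid morphism on $\{a,b\}^*$ with $\mu(a)=A$, $\mu(b)=B$, put $(r,w)=\xi'\mu(w)\eta$, and assume that for every $n\ge 1$ there is a word $w\in\{a,b\}^n$ with $(r,w)>0$. Let $Y_n$ be the number of occurrences of $a$ in a word $w\in\{a,b\}^n$ drawn at random with probability $\Pr(w)=(r,w)/\sum_{x\in\{a,b\}^n}(r,x)$. Put $M_j=A_j+B_j$ for $j=0,1,2$. Assume that $M_1$ and $M_2$ are irreducible (for every $i,j$ some positive power has a positive $(i,j)$ entry), with Perron--Frobenius eigenvalues $\lambda_1,\lambda_2$ (their spectral radii),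 that $\xi_1\neq 0\neq\eta_2$ and $M_0\neq 0$, that $\lambda_1>\lambda_2$, and that $M_1$ is primitive (some positive power is entrywise positive). Assume moreover that $(A_1,B_1)$ is aperiodic: in the directed graph on the indices $1,\dots,m_1$ having an edge $i\to j$ labelled $a$ (respectively $b$) whenever $(A_1)_{ij}>0$ (respectively $(B_1)_{ij}>0$), the greatest common divisor of all differences between the numbers of occurrences of $a$ in the labels of two cycles (closed walks) of equal length is $1$. Let $u$ be the analytic function near $z=0$ implicitly defined by $\det(Iu(z)-A_1e^z-B_1)=0$ and $u(0)=\lambda_1$, and let $$\beta_1=\frac{u'(0)}{\lambda_1},\qquad \gamma_1=\frac{u''(0)}{\lambda_1}-\left(\frac{u'(0)}{\lambda_1}\right)^2 .$$ Then $u$ exists, $\beta_1$ and $\gamma_1$ are real with $\gamma_1>0$, and, as $n\to+\infty$, $$\left|\sqrt n\,\Pr(Y_n=k)-\frac{e^{-\frac{(k-\beta_1n)^2}{2\gamma_1n}}}{\sqrt{2\pi\gamma_1}}\right|=O\left(n^{-1/2}\right)$$ uniformly for every $k\in\{0,1,\dots,n\}$. -/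

import Mathlib

noncomputable section

namespace SymbolStat

/-- The binary alphabet `{a, b}`. -/
inductive Letter : Type
  | a : Letter
  | b : Letter
deriving DecidableEq

instance : Fintype Letter where
  elems := {Letter.a, Letter.b}
  complete := by
    intro x
    cases x <;> simp

/-- A 4-tuple `(ξ, A, B, η)` of arrays with nonnegative real entries, indexed by the states `ι`. -/
structure LinRep (ι : Type) where
  ξ : ι → ℝ
  A : Matrix ι ι ℝ
  B : Matrix ι ι ℝ
  η : ι → ℝ
  ξ_nonneg : ∀ i, 0 ≤ ξ i
  A_nonneg : ∀ i j, 0 ≤ A i j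
  B_nonneg : ∀ i j, 0 ≤ B i j
  η_nonneg : ∀ i, 0 ≤ η i

namespace LinRep

variable {ι : Type}

/-- The transition matrix attached to a letter. -/
def letterMatrix (R : LinRep ι) : Letter → Matrix ι ι ℝ
  | Letter.a => R.A
  | Letter.b => R.B

/-- The total transition matrix `M = A + B`. -/
def M (R : LinRep ι) : Matrix ι ι ℝ := R.A + R.B

section Series

variable [Fintype ι] [DecidableEq ι]

/-- The monoid morphism `μ` generated by `μ(a) = A`, `μ(b) = B`. -/
def morphism (R : LinRep ι) : FreeMonoid Letter →* Matrix ι ι ℝ :=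
  FreeMonoid.lift R.letterMatrix

/-- The rational series `(r, w) = ξ' μ(w) η`. -/
def series (R : LinRep ι) (w : FreeMonoid Letter) : ℝ :=
  R.ξ ⬝ᵥ (R.morphism w).mulVec R.η

/-- The element of the free monoid given by a word of length `n`; words of length `n` are
families of letters indexed by `Fin n`. -/
def word {n : ℕ} (w : Fin n → Letter) : FreeMonoid Letter :=
  FreeMonoid.ofList (List.ofFn w)

/-- `|w|_a`, the number of occurrences of `a` in `w`. -/
def countA {n : ℕ} (w : Fin n → Letter) : ℕ := (List.ofFn w).count Letter.a

/-- For every `n ≥ 1` some word of length `n` has a positive weight. -/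
def IsAdmissible (R : LinRep ι) : Prop :=
  ∀ n : ℕ, 1 ≤ n → ∃ w : Fin n → Letter, 0 < R.series (word w)

/-- `Pr(w) = (r, w) / ∑_{|x| = n} (r, x)`, the probability of the word `w` of length `n`. -/
def probWord (R : LinRep ι) {n : ℕ} (w : Fin n → Letter) : ℝ :=
  R.series (word w) / ∑ x : Fin n → Letter, R.series (word x)

/-- `Pr(Y_n = k)`, where `Y_n = |w|_a` for a random word `w` of length `n`. -/
def probY (R : LinRep ι) (n k : ℕ) : ℝ :=
  ∑ w : Fin n → Letter with countA w = k, R.probWord w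

end Series

/-- `R.IsWalk i j w`: the transition graph has a walk from `i` to `j` with label `w`. There is an
edge from `i` to `j` labelled by a letter `c` when the matrix of `c` has a positive entry there. -/
inductive IsWalk (R : LinRep ι) : ι → ι → List Letter → Prop
  | nil (i : ι) : IsWalk R i i []
  | cons {i j k : ι} {w : List Letter} (c : Letter) (h : 0 < R.letterMatrix c i j)
      (p : IsWalk R j k w) : IsWalk R i k (c :: w)

/-- The set of all differences (in absolute value) of the number of occurrences of `a` in the
labels of two cycles (closed walks) of the same length. -/
def cycleDifferences (R : LinRep ι) : Set ℕ :=
  {d | ∃ (i j : ι) (u v : List Letter), R.IsWalk i i u ∧ R.IsWalk j j v ∧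
    u.length = v.length ∧ d = ((u.count Letter.a : ℤ) - (v.count Letter.a : ℤ)).natAbs}

/-- The pair `(A, B)` is aperiodic: the greatest common divisor of the differences is `1`. -/
def IsAperiodic (R : LinRep ι) : Prop := Nat.setGcd R.cycleDifferences = 1

section Perron

variable [Fintype ι] [DecidableEq ι]

/-- The Perron-Frobenius eigenvalue of `M = A + B`, i.e. its spectral radius over `ℂ`. -/
def perron (R : LinRep ι) : ℝ :=
  (spectralRadius ℂ (R.M.map (fun x : ℝ => (x : ℂ)))).toReal

/-- The matrix `A e^z + B`. -/
def expMatrix (R : LinRep ι) (z : ℂ) : Matrix ι ι ℂ :=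
  Complex.exp z • R.A.map (fun x : ℝ => (x : ℂ)) + R.B.map (fun x : ℝ => (x : ℂ))

/-- `u` is analytic at `0`, satisfies `u(0) = λ`, and solves `Det(I u(z) - A e^z - B) = 0` in a
neighbourhood of `0`. -/
structure IsImplicitRoot (R : LinRep ι) (u : ℂ → ℂ) : Prop where
  analytic : AnalyticAt ℂ u 0
  map_zero : u 0 = (R.perron : ℂ)
  det_eq_zero : ∀ᶠ z in nhds (0 : ℂ), (u z • (1 : Matrix ι ι ℂ) - R.expMatrix z).det = 0

/-- The function `u` implicitly defined near `0` by `Det(I u - A e^z - B) = 0`, `u(0) = λ`. -/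
def implicitRoot (R : LinRep ι) : ℂ → ℂ := Classical.epsilon R.IsImplicitRoot

/-- `β = u'(0) / λ`. -/
def beta (R : LinRep ι) : ℂ := deriv R.implicitRoot 0 / (R.perron : ℂ)

/-- `γ = u''(0) / λ - (u'(0) / λ)²`. -/
def gamma (R : LinRep ι) : ℂ :=
  iteratedDeriv 2 R.implicitRoot 0 / (R.perron : ℂ) -
    (deriv R.implicitRoot 0 / (R.perron : ℂ)) ^ 2

end Perron

/-- The block upper triangular linear representation with diagonal blocks `R₁`, `R₂` and
off-diagonal blocks `A₀`, `B₀`. -/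
def bicomponent {ι₁ ι₂ : Type} (R₁ : LinRep ι₁) (R₂ : LinRep ι₂) (A₀ B₀ : Matrix ι₁ ι₂ ℝ)
    (hA₀ : ∀ i j, 0 ≤ A₀ i j) (hB₀ : ∀ i j, 0 ≤ B₀ i j) : LinRep (ι₁ ⊕ ι₂) where
  ξ := Sum.elim R₁.ξ R₂.ξ
  A := Matrix.fromBlocks R₁.A A₀ 0 R₂.A
  B := Matrix.fromBlocks R₁.B B₀ 0 R₂.B
  η := Sum.elim R₁.η R₂.η
  ξ_nonneg := by
    rintro (i | i)
    · exact R₁.ξ_nonneg i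
    · exact R₂.ξ_nonneg i
  A_nonneg := by
    rintro (i | i) (j | j)
    · exact R₁.A_nonneg i j
    · exact hA₀ i j
    · exact le_refl _
    · exact R₂.A_nonneg i j
  B_nonneg := by
    rintro (i | i) (j | j)
    · exact R₁.B_nonneg i j
    · exact hB₀ i j
    · exact le_refl _
    · exact R₂.B_nonneg i j
  η_nonneg := by
    rintro (i | i)
    · exact R₁.η_nonneg i
    · exact R₂.η_nonneg i

end LinRep

end SymbolStat

end

set_option linter.unusedSectionVars false

/-! The characteristic function of $Y_n$ at $\theta$ is $\xi'(Ae^{i\theta}+B)^n\eta$ divided by its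
value at $\theta=0$, so the theorem is about powers of the twisted matrix $Ae^z+B$. This matrix is
block triangular, hence its characteristic polynomial is the product of those of the two blocks.
Since $\lambda_2<\lambda_1$ and $M_1$ is primitive, at $z=0$ the number $\lambda_1$ is a simple
eigenvalue and all others have smaller modulus. Perturbing the spectral projection analytically
(`exists_spectral_splitting`) gives, near $0$, $\xi'(Ae^z+B)^n\eta=\lambda_1^n\,(w(z)^n
s(z)+O(\varepsilon^n))$ with $w=u/\lambda_1$, $s$ analytic and $\varepsilon<1$. Paths from $\xi_1$
through $M_0$ to $\eta_2$ already have weight of order $\lambda_1^n$, so $s(0)\neq 0$.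

Away from $0$, the equality case of the triangle inequality for Perron vectors
(`PerronTriple.phase_eq`) and aperiodicity force every eigenvalue of the first twisted block below
$\lambda_1$ in modulus; the second block is dominated entrywise by $M_2$. Compactness makes the
decay uniform on $c\le|\theta|\le\pi$.

The variance $\gamma_1$ is a positive multiple of a weighted sum of squares over the edges
(`PerronTriple.variance_identity`). If it vanished, the number of $a$'s along a cycle would depend
only on its length, against aperiodicity.

Finally $w(i\theta)^n$ agrees with $e^{n(\beta_1 i\theta-\gamma_1\theta^2/2)}$ up to
$n|\theta|^3e^{-an\theta^2}$, and replacing $s(i\theta)/s(0)$ by $1$ costs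
$|\theta|e^{-an\theta^2}$, up to constants. Both errors integrate to $O(1/n)$, so Fourier inversion
followed by multiplication by $\sqrt n$ leaves $O(n^{-1/2})$. -/

section

open Matrix Finset Complex

namespace SymbolStat

/-! ### Perron–Frobenius theory of primitive matrices -/

section Perron

variable {ι : Type*} [Fintype ι] [DecidableEq ι]

/-- `r` is a positive eigenvalue of `M` with positive right eigenvector `v` and positive left
eigenvector `l`. -/
structure PerronTriple (M : Matrix ι ι ℝ) (r : ℝ) (v l : ι → ℝ) : Prop where
  r_pos : 0 < r
  v_pos : ∀ i, 0 < v i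
  l_pos : ∀ i, 0 < l i
  mulVec_eq : M *ᵥ v = r • v
  vecMul_eq : l ᵥ* M = r • l

theorem mulVec_pos_of_pos {M : Matrix ι ι ℝ} (hM : ∀ i j, 0 < M i j) {x : ι → ℝ}
    (hx : ∀ i, 0 ≤ x i) (hx0 : x ≠ 0) (i : ι) : 0 < (M *ᵥ x) i := by
  obtain ⟨j, hj⟩ := Function.ne_iff.1 hx0
  have hj' : 0 < x j := lt_of_le_of_ne (hx j) (Ne.symm hj)
  exact sum_pos' (fun k _ => mul_nonneg (hM i k).le (hx k)) ⟨j, mem_univ _, mul_pos (hM i j) hj'⟩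

theorem pow_mulVec_eq {R : Type*} [CommRing R] {M : Matrix ι ι R} {r : R} {x : ι → R}
    (h : M *ᵥ x = r • x) (k : ℕ) : (M ^ k) *ᵥ x = r ^ k • x := by
  induction k with
  | zero => simp
  | succ k ih => rw [pow_succ, ← mulVec_mulVec, h, mulVec_smul, ih, smul_smul, pow_succ']

theorem vecMul_pow_eq {R : Type*} [CommRing R] {M : Matrix ι ι R} {r : R} {x : ι → R}
    (h : x ᵥ* M = r • x) (k : ℕ) : x ᵥ* (M ^ k) = r ^ k • x := by
  induction k with
  | zero => simp
  | succ k ih => rw [pow_succ', ← vecMul_vecMul, h, smul_vecMul, ih, smul_smul, pow_succ']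

/-- Collatz–Wielandt by compactness: on the simplex every $y_j\le 1$, so an admissible nonnegative
factor is at most the sum of all entries of `M`. The admissible pairs with nonnegative factor form a
nonempty compact set, on which the factor attains its maximum. -/
theorem exists_maximal_subinvariant [Nonempty ι] (M : Matrix ι ι ℝ) (hM : ∀ i j, 0 ≤ M i j) :
    ∃ t : ℝ, 0 ≤ t ∧ ∃ x ∈ stdSimplex ℝ ι, (∀ i, t * x i ≤ (M *ᵥ x) i) ∧
      ∀ s : ℝ, ∀ y ∈ stdSimplex ℝ ι, (∀ i, s * y i ≤ (M *ᵥ y) i) → s ≤ t := by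
  set R : ℝ := ∑ i, ∑ j, M i j with hR
  have hR0 : 0 ≤ R := sum_nonneg fun i _ => sum_nonneg fun j _ => hM i j
  let S : Set (ℝ × (ι → ℝ)) :=
    (Set.Icc 0 R ×ˢ stdSimplex ℝ ι) ∩ {p | ∀ i, p.1 * p.2 i ≤ (M *ᵥ p.2) i}
  have hScl : IsClosed {p : ℝ × (ι → ℝ) | ∀ i, p.1 * p.2 i ≤ (M *ᵥ p.2) i} := by
    simp only [Set.ofPred_forall]
    refine isClosed_iInter fun i => isClosed_le (by fun_prop) ?_
    simp only [mulVec, dotProduct]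
    fun_prop
  have hSc : IsCompact S := (isCompact_Icc.prod (isCompact_stdSimplex ℝ ι)).inter_right hScl
  obtain ⟨i₀⟩ := ‹Nonempty ι›
  have hSne : S.Nonempty := by
    refine ⟨(0, Pi.single i₀ 1), ⟨⟨le_refl _, hR0⟩, single_mem_stdSimplex ℝ i₀⟩, fun i => ?_⟩
    simpa using hM i i₀
  obtain ⟨⟨t, x⟩, ⟨⟨ht, hx⟩, htx⟩, hmax⟩ := hSc.exists_isMaxOn hSne continuous_fst.continuousOn
  refine ⟨t, ht.1, x, hx, htx, fun s y hy hsy => ?_⟩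
  rcases lt_or_ge s 0 with hs | hs
  · exact hs.le.trans ht.1
  refine hmax (a := (s, y)) ⟨⟨⟨hs, ?_⟩, hy⟩, hsy⟩
  have h1 : ∑ i, s * y i ≤ ∑ i, (M *ᵥ y) i := sum_le_sum fun i _ => hsy i
  rw [← mul_sum, hy.2, mul_one] at h1
  refine h1.trans (sum_le_sum fun i _ => sum_le_sum fun j _ => ?_)
  have : y j ≤ 1 := hy.2 ▸ single_le_sum (f := y) (fun k _ => hy.1 k) (mem_univ j)
  exact mul_le_of_le_one_right (hM i j) this

theorem exists_pos_eigenvector [Nonempty ι] {M : Matrix ι ι ℝ} (hM : M.IsPrimitive) :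
    ∃ r : ℝ, 0 < r ∧ ∃ v : ι → ℝ, (∀ i, 0 < v i) ∧ M *ᵥ v = r • v := by
  obtain ⟨t, ht, x, hx, htx, hmax⟩ := exists_maximal_subinvariant M hM.nonneg
  obtain ⟨k, hk, hpos⟩ := hM.exists_pos_pow
  have hx0 : x ≠ 0 := by
    rintro rfl
    have := hx.2
    simp at this
  have key : M *ᵥ x = t • x := by
    by_contra hne
    have hd0 : M *ᵥ x - t • x ≠ 0 := sub_ne_zero.2 hne
    have hd : ∀ i, 0 ≤ (M *ᵥ x - t • x) i := fun i => by simpa using htx i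
    set y := (M ^ k) *ᵥ x with hy
    have hypos : ∀ i, 0 < y i := mulVec_pos_of_pos hpos hx.1 hx0
    have hylt : ∀ i, t * y i < (M *ᵥ y) i := by
      intro i
      have := mulVec_pos_of_pos hpos hd hd0 i
      rw [mulVec_sub, mulVec_smul, mulVec_mulVec, ← pow_succ, pow_succ', ← mulVec_mulVec] at this
      simpa [hy] using this
    obtain ⟨i₁, -, hi₁⟩ := exists_min_image univ (fun i => (M *ᵥ y) i / y i) univ_nonempty
    set s := (M *ᵥ y) i₁ / y i₁ with hs
    have hts : t < s := (lt_div_iff₀ (hypos i₁)).2 (hylt i₁)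
    have hsum : 0 < ∑ i, y i := sum_pos (fun i _ => hypos i) univ_nonempty
    refine absurd (hmax s ((∑ i, y i)⁻¹ • y) ⟨fun i => ?_, ?_⟩ fun i => ?_) (not_le.2 hts)
    · exact mul_nonneg (inv_pos.2 hsum).le (hypos i).le
    · simp only [Pi.smul_apply, smul_eq_mul]
      rw [← mul_sum, inv_mul_cancel₀ hsum.ne']
    · rw [mulVec_smul]
      simp only [Pi.smul_apply, smul_eq_mul]
      have h1 := (le_div_iff₀ (hypos i)).1 (hi₁ i (mem_univ i))
      have h2 := mul_le_mul_of_nonneg_left h1 (inv_pos.2 hsum).le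
      linarith
  have hkx := pow_mulVec_eq key k
  have hpos' := mulVec_pos_of_pos hpos hx.1 hx0
  have htk : ∀ i, 0 < t ^ k * x i := fun i => by
    have := hpos' i
    rwa [hkx] at this
  have ht0 : 0 < t := by
    refine lt_of_le_of_ne ht fun h => ?_
    obtain ⟨i⟩ := ‹Nonempty ι›
    have := htk i
    rw [← h, zero_pow hk.ne', zero_mul] at this
    exact lt_irrefl _ this
  exact ⟨t, ht0, x, fun i => pos_of_mul_pos_right (htk i) (pow_nonneg ht k), key⟩

theorem dotProduct_pos_of_pos [Nonempty ι] {v l : ι → ℝ} (hv : ∀ i, 0 < v i) (hl : ∀ i, 0 < l i) :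
    0 < l ⬝ᵥ v :=
  sum_pos (fun i _ => mul_pos (hl i) (hv i)) univ_nonempty

/-- The transpose supplies the left vector; its eigenvalue is the same because $l\cdot Mv$ can be
computed from either side and $l\cdot v>0$. -/
theorem exists_perronTriple [Nonempty ι] {M : Matrix ι ι ℝ} (hM : M.IsPrimitive) :
    ∃ r v l, PerronTriple M r v l := by
  obtain ⟨r, hr, v, hv, hMv⟩ := exists_pos_eigenvector hM
  have hMT : Mᵀ.IsPrimitive := by
    obtain ⟨k, hk, hpos⟩ := hM.exists_pos_pow
    exact ⟨fun i j => hM.nonneg j i, k, hk, fun i j => by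
      rw [← transpose_pow]
      exact hpos j i⟩
  obtain ⟨s, hs, l, hl, hMl⟩ := exists_pos_eigenvector hMT
  rw [mulVec_transpose] at hMl
  have h : l ⬝ᵥ (M *ᵥ v) = (l ᵥ* M) ⬝ᵥ v := dotProduct_mulVec l M v
  rw [hMl, hMv, dotProduct_smul, smul_dotProduct, smul_eq_mul, smul_eq_mul] at h
  have := mul_right_cancel₀ (dotProduct_pos_of_pos hv hl).ne' h
  exact ⟨r, v, l, hr, hv, hl, hMv, this ▸ hMl⟩

namespace PerronTriple

variable {M : Matrix ι ι ℝ} {r : ℝ} {v l : ι → ℝ}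

theorem pow (h : PerronTriple M r v l) (k : ℕ) : PerronTriple (M ^ k) (r ^ k) v l where
  r_pos := pow_pos h.r_pos k
  v_pos := h.v_pos
  l_pos := h.l_pos
  mulVec_eq := pow_mulVec_eq h.mulVec_eq k
  vecMul_eq := vecMul_pow_eq h.vecMul_eq k

theorem dotProduct_mulVec_eq (h : PerronTriple M r v l) (x : ι → ℝ) :
    l ⬝ᵥ (M *ᵥ x) = r * (l ⬝ᵥ x) := by
  rw [dotProduct_mulVec, h.vecMul_eq, smul_dotProduct, smul_eq_mul]

/-- Pairing with the positive left eigenvector makes the weighted sum of the nonnegative defects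
zero, so each defect vanishes. -/
theorem eq_of_smul_le (h : PerronTriple M r v l) {x : ι → ℝ} (hx : ∀ i, r * x i ≤ (M *ᵥ x) i) :
    M *ᵥ x = r • x := by
  have h0 : ∑ i, l i * ((M *ᵥ x) i - r * x i) = 0 := by
    have := h.dotProduct_mulVec_eq x
    simp only [dotProduct] at this
    simp only [mul_sub, sum_sub_distrib, this, mul_sum]
    rw [sub_eq_zero]
    exact sum_congr rfl fun i _ => by ring
  have h1 := (sum_eq_zero_iff_of_nonneg fun i _ =>
    mul_nonneg (h.l_pos i).le (sub_nonneg.2 (hx i))).1 h0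
  ext i
  have := (mul_eq_zero.1 (h1 i (mem_univ i))).resolve_left (h.l_pos i).ne'
  simpa [sub_eq_zero] using this

theorem pos_of_eigenvector (h : PerronTriple M r v l) (hM : M.IsPrimitive) {x : ι → ℝ}
    (hx : ∀ i, 0 ≤ x i) (hx0 : x ≠ 0) (hMx : M *ᵥ x = r • x) (i : ι) : 0 < x i := by
  obtain ⟨k, hk, hpos⟩ := hM.exists_pos_pow
  have := mulVec_pos_of_pos hpos hx hx0 i
  rw [pow_mulVec_eq hMx] at this
  exact pos_of_mul_pos_right this (pow_nonneg h.r_pos.le k)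

/-- Subtract the largest multiple of `v` that keeps the difference nonnegative: it has a zero entry,
whereas a nonzero nonnegative eigenvector for `r` is strictly positive. -/
theorem eq_smul_of_eigenvector [Nonempty ι] (h : PerronTriple M r v l) (hM : M.IsPrimitive)
    {x : ι → ℝ} (hMx : M *ᵥ x = r • x) : ∃ c : ℝ, x = c • v := by
  obtain ⟨i₁, -, hi₁⟩ := exists_min_image univ (fun i => x i / v i) univ_nonempty
  refine ⟨x i₁ / v i₁, ?_⟩
  by_contra hne
  have h1 : M *ᵥ (x - (x i₁ / v i₁) • v) = r • (x - (x i₁ / v i₁) • v) := by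
    rw [mulVec_sub, mulVec_smul, hMx, h.mulVec_eq, smul_sub, smul_comm]
  have h2 := h.pos_of_eigenvector hM (fun i => ?_) (sub_ne_zero.2 hne) h1 i₁
  · have := (h.v_pos i₁).ne'
    simp [this] at h2
  · have := (le_div_iff₀ (h.v_pos i)).1 (hi₁ i (mem_univ i))
    simpa using this

theorem eq_smul_of_complex_eigenvector [Nonempty ι] (h : PerronTriple M r v l)
    (hM : M.IsPrimitive) {w : ι → ℂ} (hw : (M.map (fun x : ℝ => (x : ℂ))) *ᵥ w = (r : ℂ) • w) :
    ∃ c : ℂ, w = c • fun i => (v i : ℂ) := by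
  have hi : ∀ i, ∑ j, (M i j : ℂ) * w j = r * w i := fun i => congrFun hw i
  obtain ⟨a, ha⟩ := h.eq_smul_of_eigenvector hM (x := fun i => (w i).re) (by
    ext i
    have := congrArg Complex.re (hi i)
    simpa [Complex.re_sum, mulVec, dotProduct] using this)
  obtain ⟨b, hb⟩ := h.eq_smul_of_eigenvector hM (x := fun i => (w i).im) (by
    ext i
    have := congrArg Complex.im (hi i)
    simpa [Complex.im_sum, mulVec, dotProduct] using this)
  refine ⟨⟨a, b⟩, funext fun i => Complex.ext ?_ ?_⟩
  · simpa using congrFun ha i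
  · simpa using congrFun hb i

/-- An eigenvector `w` of maximal modulus of a complex matrix dominated by `M` has positive
moduli, proportional to the Perron vector. -/
theorem abs_eigenvector (h : PerronTriple M r v l) (hM : M.IsPrimitive) {T : Matrix ι ι ℂ}
    (hT : ∀ i j, ‖T i j‖ ≤ M i j) {w : ι → ℂ} (hw0 : w ≠ 0) {μ : ℂ} (hμ : r ≤ ‖μ‖)
    (hw : T *ᵥ w = μ • w) : (∀ i, 0 < ‖w i‖) ∧ M *ᵥ (fun i => ‖w i‖) = r • fun i => ‖w i‖ := by
  have h1 : ∀ i, ‖μ‖ * ‖w i‖ ≤ (M *ᵥ fun i => ‖w i‖) i := by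
    intro i
    have : ∑ j, T i j * w j = μ * w i := congrFun hw i
    rw [← norm_mul, ← this]
    refine (norm_sum_le _ _).trans (sum_le_sum fun j _ => ?_)
    rw [norm_mul]
    exact mul_le_mul_of_nonneg_right (hT i j) (norm_nonneg _)
  have h2 := h.eq_of_smul_le (x := fun i => ‖w i‖) fun i =>
    (mul_le_mul_of_nonneg_right hμ (norm_nonneg _)).trans (h1 i)
  refine ⟨h.pos_of_eigenvector hM (fun i => norm_nonneg _) (fun h0 => hw0 ?_) h2, h2⟩
  ext i
  simpa using congrFun h0 i

theorem norm_eigenvalue_le (h : PerronTriple M r v l) {T : Matrix ι ι ℂ}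
    (hT : ∀ i j, ‖T i j‖ ≤ M i j) {w : ι → ℂ} (hw0 : w ≠ 0) {μ : ℂ}
    (hw : T *ᵥ w = μ • w) : ‖μ‖ ≤ r := by
  have h1 : ∀ i, ‖μ‖ * ‖w i‖ ≤ (M *ᵥ fun i => ‖w i‖) i := by
    intro i
    have : ∑ j, T i j * w j = μ * w i := congrFun hw i
    rw [← norm_mul, ← this]
    refine (norm_sum_le _ _).trans (sum_le_sum fun j _ => ?_)
    rw [norm_mul]
    exact mul_le_mul_of_nonneg_right (hT i j) (norm_nonneg _)
  have h2 : ‖μ‖ * (l ⬝ᵥ fun i => ‖w i‖) ≤ r * (l ⬝ᵥ fun i => ‖w i‖) := by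
    rw [← h.dotProduct_mulVec_eq]
    simp only [dotProduct, mul_sum]
    refine sum_le_sum fun i _ => ?_
    have := mul_le_mul_of_nonneg_left (h1 i) (h.l_pos i).le
    linarith
  obtain ⟨i, hi⟩ := Function.ne_iff.1 hw0
  refine le_of_mul_le_mul_right h2 (sum_pos' (fun j _ => mul_nonneg (h.l_pos j).le (norm_nonneg _))
    ⟨i, mem_univ i, mul_pos (h.l_pos i) (norm_pos_iff.2 hi)⟩)

theorem eq_of_norm_le_of_re_eq {z : ℂ} {m : ℝ} (h1 : ‖z‖ ≤ m) (h2 : z.re = m) : z = m := by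
  refine Complex.ext h2 ?_
  have h3 := Complex.sq_norm z
  rw [Complex.normSq_apply] at h3
  have h4 : ‖z‖ ^ 2 ≤ m ^ 2 := pow_le_pow_left₀ (norm_nonneg _) h1 2
  have h5 : z.im * z.im ≤ 0 := by rw [h2] at h3; nlinarith
  simpa using mul_self_eq_zero.1 (le_antisymm h5 (mul_self_nonneg _))

/-- The equality case of the triangle inequality for eigenvectors of maximal modulus. -/
theorem phase_eq (h : PerronTriple M r v l) (hM : M.IsPrimitive) {T : Matrix ι ι ℂ}
    (hT : ∀ i j, ‖T i j‖ ≤ M i j) {w : ι → ℂ} (hw0 : w ≠ 0) {μ : ℂ} (hμ : ‖μ‖ = r)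
    (hw : T *ᵥ w = μ • w) (i j : ι) :
    T i j * (w j / ‖w j‖) = M i j * ((μ / r) * (w i / ‖w i‖)) := by
  obtain ⟨hpos, hMw⟩ := h.abs_eigenvector hM hT hw0 hμ.ge hw
  have hr := h.r_pos
  set s : ι → ℂ := fun i => w i / ‖w i‖ with hs
  have hs1 : ∀ i, ‖s i‖ = 1 := fun i => by simp [hs, (hpos i).ne']
  have hws : ∀ i, w i = ‖w i‖ * s i := fun i => by
    have : (‖w i‖ : ℂ) ≠ 0 := by exact_mod_cast (hpos i).ne'
    simp only [hs]; field_simp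
  set κ : ℂ := μ / r with hκ
  have hκ1 : ‖κ‖ = 1 := by simp [hκ, hμ, abs_of_pos hr, hr.ne']
  -- Multiplication by the conjugate phase `c` rotates row `i` so that its terms sum to a real
  -- number equal to the sum of their bounds. Each real part must then reach its bound.
  set c : ℂ := (starRingEnd ℂ) (κ * s i) with hc
  have hcn : ‖c‖ = 1 := by rw [hc, RCLike.norm_conj, norm_mul, hκ1, hs1, one_mul]
  have hcmul : c * (κ * s i) = 1 := by
    rw [hc, mul_comm, Complex.mul_conj, Complex.normSq_eq_norm_sq, norm_mul, hκ1, hs1]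
    simp
  have hsum : ∑ j, (c * (T i j * s j)) * ‖w j‖ = (∑ j, M i j * ‖w j‖ : ℝ) := by
    have h1 : ∑ j, T i j * w j = μ * w i := congrFun hw i
    have h2 : ∑ j, M i j * ‖w j‖ = r * ‖w i‖ := congrFun hMw i
    have h3 : ∑ j, (c * (T i j * s j)) * ‖w j‖ = c * ∑ j, T i j * w j := by
      rw [mul_sum]
      refine sum_congr rfl fun j _ => ?_
      conv_rhs => rw [hws j]
      ring
    have h4 : μ = r * κ := by
      have : (r : ℂ) ≠ 0 := by exact_mod_cast hr.ne'
      rw [hκ]; field_simp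
    rw [h3, h1, h2, h4, hws i]
    push_cast
    rw [norm_mul, hs1, mul_one, Complex.norm_real, norm_norm]
    linear_combination (r : ℂ) * ‖w i‖ * hcmul
  have hle : ∀ j, ‖c * (T i j * s j)‖ ≤ M i j := fun j => by
    rw [norm_mul, norm_mul, hcn, hs1, one_mul, mul_one]; exact hT i j
  have hre : ∀ j, (c * (T i j * s j)).re = M i j := by
    have h5 : ∑ j, (M i j - (c * (T i j * s j)).re) * ‖w j‖ = 0 := by
      have := congrArg Complex.re hsum
      rw [Complex.re_sum, Complex.ofReal_re] at this
      simp only [Complex.re_mul_ofReal] at this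
      simp only [sub_mul, sum_sub_distrib, this, sub_self]
    have h6 := (sum_eq_zero_iff_of_nonneg fun j _ => mul_nonneg
      (sub_nonneg.2 ((Complex.re_le_norm _).trans (hle j))) (norm_nonneg _)).1 h5
    intro j
    have := (mul_eq_zero.1 (h6 j (mem_univ j))).resolve_right (hpos j).ne'
    linarith
  have h7 := eq_of_norm_le_of_re_eq (hle j) (hre j)
  calc T i j * s j = (c * (κ * s i)) * (T i j * s j) := by rw [hcmul, one_mul]
    _ = (c * (T i j * s j)) * (κ * s i) := by ring
    _ = M i j * (κ * s i) := by rw [h7]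

/-- For a primitive matrix the Perron eigenvalue is the only one of maximal modulus. -/
theorem eigenvalue_eq_or_lt (h : PerronTriple M r v l) (hM : M.IsPrimitive) {w : ι → ℂ}
    (hw0 : w ≠ 0) {μ : ℂ} (hw : M.map (fun x : ℝ => (x : ℂ)) *ᵥ w = μ • w) :
    μ = r ∨ ‖μ‖ < r := by
  have hT : ∀ i j, ‖M.map (fun x : ℝ => (x : ℂ)) i j‖ ≤ M i j := fun i j => by
    simp [abs_of_nonneg (hM.nonneg i j)]
  rcases (h.norm_eigenvalue_le hT hw0 hw).lt_or_eq with hlt | heq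
  · exact Or.inr hlt
  left
  -- Passing to $M^k$ makes every entry nonzero, so the phase relation links all pairs of indices
  -- and all $w_j$ share one phase. Thus `w` is a scalar multiple of its vector of moduli, an
  -- eigenvector for `r`.
  obtain ⟨k, hk, hpos⟩ := hM.exists_pos_pow
  have hprim : (M ^ k).IsPrimitive := ⟨fun i j => (hpos i j).le, 1, one_pos, by simpa using hpos⟩
  have hmap : (M.map (fun x : ℝ => (x : ℂ))) ^ k = (M ^ k).map (fun x : ℝ => (x : ℂ)) :=
    (Matrix.map_pow M k (f := Complex.ofRealHom)).symm
  have hphase := (h.pow k).phase_eq hprim (T := (M ^ k).map (fun x : ℝ => (x : ℂ)))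
    (fun i j => by simp [abs_of_nonneg (hpos i j).le]) hw0 (μ := μ ^ k) (by rw [norm_pow, heq])
    (by rw [← hmap]; exact pow_mulVec_eq hw k)
  obtain ⟨hwpos, hMw⟩ := h.abs_eigenvector hM hT hw0 heq.ge hw
  have hs : ∀ i j, w j / ‖w j‖ = (μ ^ k / (r ^ k : ℝ)) * (w i / ‖w i‖) := fun i j => by
    have h1 := hphase i j
    have h2 : ((M ^ k) i j : ℂ) ≠ 0 := by exact_mod_cast (hpos i j).ne'
    exact mul_left_cancel₀ h2 h1
  obtain ⟨i, hi⟩ := Function.ne_iff.1 hw0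
  have hconst : ∀ j, w j = (w i / ‖w i‖) * ‖w j‖ := fun j => by
    have h1 : w j / ‖w j‖ = w i / ‖w i‖ := (hs i j).trans (hs i i).symm
    have h2 : (‖w j‖ : ℂ) ≠ 0 := by exact_mod_cast (hwpos j).ne'
    rw [← h1]; field_simp
  have h1 : ∑ j, (M i j : ℂ) * w j = μ * w i := congrFun hw i
  have h2 : ∑ j, M i j * ‖w j‖ = r * ‖w i‖ := congrFun hMw i
  have h3 : ∑ j, (M i j : ℂ) * w j = r * w i := by
    calc ∑ j, (M i j : ℂ) * w j = (w i / ‖w i‖) * ((∑ j, M i j * ‖w j‖ : ℝ) : ℂ) := by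
          push_cast
          rw [mul_sum]
          refine sum_congr rfl fun j _ => ?_
          conv_lhs => rw [hconst j]
          ring
      _ = r * w i := by
          rw [h2]
          conv_rhs => rw [hconst i]
          push_cast; ring
  exact mul_right_cancel₀ hi (h1.symm.trans h3)

end PerronTriple

end Perron

end SymbolStat

end

section

open Matrix Finset Complex Filter Polynomial
open scoped Topology NNReal ENNReal Matrix.Norms.Operator

namespace SymbolStat

/-! ### Spectral radius and simplicity of the Perron root -/

section Eigenvalues

variable {ι : Type*} [Fintype ι] [DecidableEq ι]

theorem isRoot_charpoly_iff {T : Matrix ι ι ℂ} {μ : ℂ} :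
    T.charpoly.IsRoot μ ↔ ∃ w ≠ 0, T *ᵥ w = μ • w := by
  rw [Polynomial.IsRoot.def, Matrix.eval_charpoly, ← Matrix.exists_mulVec_eq_zero_iff]
  refine exists_congr fun w => and_congr_right fun _ => ?_
  rw [sub_mulVec, sub_eq_zero, eq_comm, show scalar ι μ = μ • (1 : Matrix ι ι ℂ) from
    Algebra.algebraMap_eq_smul_one μ, smul_mulVec, one_mulVec]

theorem mem_spectrum_iff_exists {T : Matrix ι ι ℂ} {μ : ℂ} :
    μ ∈ spectrum ℂ T ↔ ∃ w ≠ 0, T *ᵥ w = μ • w := by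
  rw [← isRoot_charpoly_iff, spectrum.mem_iff, Matrix.isUnit_iff_isUnit_det, isUnit_iff_ne_zero,
    not_not, Polynomial.IsRoot.def, Matrix.eval_charpoly]
  rfl

theorem PerronTriple.spectralRadius_eq [Nonempty ι] {M : Matrix ι ι ℝ} {r : ℝ} {v l : ι → ℝ}
    (h : PerronTriple M r v l) (hM : M.IsPrimitive) :
    spectralRadius ℂ (M.map (fun x : ℝ => (x : ℂ))) = ENNReal.ofReal r := by
  refine le_antisymm (iSup₂_le fun μ hμ => ?_) ?_
  · obtain ⟨w, hw0, hw⟩ := mem_spectrum_iff_exists.1 hμ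
    have := h.norm_eigenvalue_le (fun i j => by simp [abs_of_nonneg (hM.nonneg i j)]) hw0 hw
    rw [← enorm_eq_nnnorm, ← ofReal_norm]
    exact ENNReal.ofReal_le_ofReal this
  · have hmem : (r : ℂ) ∈ spectrum ℂ (M.map (fun x : ℝ => (x : ℂ))) := by
      refine mem_spectrum_iff_exists.2 ⟨fun i => (v i : ℂ), fun h0 => ?_, ?_⟩
      · obtain ⟨i⟩ := ‹Nonempty ι›
        have := congrFun h0 i
        exact (h.v_pos i).ne' (by simpa using this)
      · ext i
        have := congrFun h.mulVec_eq i
        simp only [mulVec, dotProduct, map_apply, Pi.smul_apply, smul_eq_mul] at this ⊢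
        exact_mod_cast this
    refine le_trans (le_of_eq ?_) (le_iSup₂ (f := fun k (_ : k ∈ spectrum ℂ _) => (‖k‖₊ : ℝ≥0∞))
      (r : ℂ) hmem)
    rw [← enorm_eq_nnnorm, ← ofReal_norm, Complex.norm_real, Real.norm_of_nonneg h.r_pos.le]

/-- There is no Jordan chain at `r`: the range of $M-r$ is orthogonal to `l`, while its kernel is
spanned by `v` and $l\cdot v>0$, so range and kernel meet only in $0$. -/
theorem PerronTriple.ker_pow [Nonempty ι] {M : Matrix ι ι ℝ} {r : ℝ} {v l : ι → ℝ}
    (h : PerronTriple M r v l) (hM : M.IsPrimitive) (k : ℕ) {w : ι → ℂ}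
    (hw : (toLin' (M.map (fun x : ℝ => (x : ℂ))) - algebraMap ℂ (Module.End ℂ (ι → ℂ)) r) ^ k • w
      = 0) : (M.map (fun x : ℝ => (x : ℂ))) *ᵥ w = (r : ℂ) • w := by
  set f := toLin' (M.map (fun x : ℝ => (x : ℂ))) - algebraMap ℂ (Module.End ℂ (ι → ℂ)) r with hf
  have hfw : ∀ w, f w = (M.map (fun x : ℝ => (x : ℂ))) *ᵥ w - (r : ℂ) • w := fun w => by
    simp [hf, Module.algebraMap_end_apply]
  have hlf : ∀ w, (fun i => (l i : ℂ)) ⬝ᵥ f w = 0 := fun w => by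
    have : (fun i => (l i : ℂ)) ᵥ* (M.map (fun x : ℝ => (x : ℂ))) = (r : ℂ) • fun i => (l i : ℂ) := by
      ext i
      have := congrFun h.vecMul_eq i
      simp only [vecMul, dotProduct, map_apply, Pi.smul_apply, smul_eq_mul] at this ⊢
      exact_mod_cast this
    rw [hfw, dotProduct_sub, dotProduct_mulVec, this, smul_dotProduct, dotProduct_smul, sub_self]
  have h2 : ∀ w, f (f w) = 0 → f w = 0 := by
    intro w hw
    have h3 := hfw (f w)
    rw [hw, eq_comm, sub_eq_zero] at h3
    obtain ⟨c, hc⟩ := h.eq_smul_of_complex_eigenvector hM h3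
    have h4 := hlf w
    rw [hc, dotProduct_smul, smul_eq_mul, mul_eq_zero] at h4
    rcases h4 with h4 | h4
    · rw [hc, h4, zero_smul]
    · exfalso
      have h5 := dotProduct_pos_of_pos h.v_pos h.l_pos
      simp only [dotProduct] at h4 h5
      exact h5.ne' (by exact_mod_cast h4)
  have h6 : ∀ k : ℕ, ∀ w, (f ^ (k + 1)) w = 0 → f w = 0 := by
    intro k
    induction k with
    | zero => intro w hw; simpa using hw
    | succ k ih =>
      intro w hw
      rw [pow_succ, Module.End.mul_apply] at hw
      exact h2 w (ih _ hw)
  rw [← sub_eq_zero, ← hfw]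
  cases k with
  | zero => simp only [pow_zero, one_smul] at hw; rw [hw, map_zero]
  | succ k => exact h6 k w hw

/-- A vanishing derivative would make `r` a root of multiplicity at least two. The multiplicity is
the dimension of the generalized eigenspace, which is the line spanned by `v`. -/
theorem PerronTriple.derivative_charpoly_ne_zero [Nonempty ι] {M : Matrix ι ι ℝ} {r : ℝ}
    {v l : ι → ℝ} (h : PerronTriple M r v l) (hM : M.IsPrimitive) :
    (M.map (fun x : ℝ => (x : ℂ))).charpoly.derivative.eval (r : ℂ) ≠ 0 := by
  set T := M.map (fun x : ℝ => (x : ℂ))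
  intro h0
  have hroot : T.charpoly.IsRoot (r : ℂ) :=
    isRoot_charpoly_iff.2 (mem_spectrum_iff_exists.1 (by
      refine mem_spectrum_iff_exists.2 ⟨fun i => (v i : ℂ), fun h0 => ?_, ?_⟩
      · obtain ⟨i⟩ := ‹Nonempty ι›
        have := congrFun h0 i
        exact (h.v_pos i).ne' (by simpa using this)
      · ext i
        have := congrFun h.mulVec_eq i
        simp only [T, mulVec, dotProduct, map_apply, Pi.smul_apply, smul_eq_mul] at this ⊢
        exact_mod_cast this))
  have h1 := (Polynomial.one_lt_rootMultiplicity_iff_isRoot (T.charpoly_monic.ne_zero)).2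
    ⟨hroot, h0⟩
  have h2 := (toLin' T).finrank_maxGenEigenspace_eq (r : ℂ)
  have h3 : (toLin' T).charpoly = T.charpoly := by simp
  rw [h3] at h2
  rw [← h2] at h1
  refine absurd h1 (not_lt.2 ?_)
  have hv : (fun i => (v i : ℂ)) ∈ Module.End.maxGenEigenspace (toLin' T) (r : ℂ) := by
    refine Module.End.mem_maxGenEigenspace _ _ _ |>.2 ⟨1, ?_⟩
    ext i
    have := congrFun h.mulVec_eq i
    simp only [mulVec, dotProduct, Pi.smul_apply, smul_eq_mul] at this
    simp only [T, pow_one, LinearMap.sub_apply, toLin'_apply, LinearMap.smul_apply,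
      Module.End.one_apply, Pi.sub_apply, mulVec, dotProduct, map_apply, Pi.smul_apply, smul_eq_mul,
      Pi.zero_apply, sub_eq_zero]
    exact_mod_cast this
  refine finrank_le_one ⟨_, hv⟩ fun w => ?_
  obtain ⟨k, hk⟩ := (Module.End.mem_maxGenEigenspace _ _ _).1 w.2
  obtain ⟨c, hc⟩ := h.eq_smul_of_complex_eigenvector hM (h.ker_pow hM k hk)
  exact ⟨c, Subtype.ext hc.symm⟩

end Eigenvalues

/-! ### Locally uniform bounds on matrix powers -/

section PowerBound

/-- Gelfand's formula gives one exponent `N` with $\|S(x_0)^N\|<\rho^N$, and this strict inequality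
persists near $x_0$. Euclidean division of `n` by `N` then bounds all powers with one constant that
absorbs the finitely many remainders. -/
theorem eventually_norm_pow_le {X 𝔸 : Type*} [TopologicalSpace X] [NormedRing 𝔸]
    [NormedAlgebra ℂ 𝔸] [CompleteSpace 𝔸] {S : X → 𝔸} {x₀ : X} (hS : ContinuousAt S x₀) {ρ : ℝ≥0}
    (h : spectralRadius ℂ (S x₀) < ρ) :
    ∃ C : ℝ, 0 ≤ C ∧ ∀ᶠ x in 𝓝 x₀, ∀ n : ℕ, ‖S x ^ n‖ ≤ C * (ρ : ℝ) ^ n := by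
  have hρ : 0 < (ρ : ℝ) := by
    have : (0 : ℝ≥0∞) < ρ := lt_of_le_of_lt zero_le h
    exact_mod_cast this
  have h1 := (spectrum.pow_nnnorm_pow_one_div_tendsto_nhds_spectralRadius (S x₀)).eventually_lt_const h
  obtain ⟨N, hN, hN0⟩ := (h1.and (eventually_gt_atTop 0)).exists
  have h2 : ‖S x₀ ^ N‖ < (ρ : ℝ) ^ N := by
    have hN' : (0 : ℝ) < N := by exact_mod_cast hN0
    have h3 := ENNReal.rpow_lt_rpow hN hN'
    rw [← ENNReal.rpow_mul, one_div_mul_cancel hN'.ne', ENNReal.rpow_one,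
      ENNReal.rpow_natCast] at h3
    exact_mod_cast h3
  have h4 : ∀ᶠ x in 𝓝 x₀, ‖S x ^ N‖ < (ρ : ℝ) ^ N := (hS.pow N).norm.eventually_lt_const h2
  have h5 : ∀ᶠ x in 𝓝 x₀, ∀ m ∈ range N, ‖S x ^ m‖ < ‖S x₀ ^ m‖ + 1 :=
    (eventually_all_finset _).2 fun m _ => (hS.pow m).norm.eventually_lt_const (lt_add_one _)
  refine ⟨∑ m ∈ range N, (‖S x₀ ^ m‖ + 1) / (ρ : ℝ) ^ m, by positivity, ?_⟩
  filter_upwards [h4, h5] with x hx4 hx5 n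
  have hmul : ∀ (q : ℕ) (b : 𝔸), ‖(S x ^ N) ^ q * b‖ ≤ ((ρ : ℝ) ^ N) ^ q * ‖b‖ := by
    intro q b
    induction q with
    | zero => simp
    | succ q ih =>
      rw [pow_succ', pow_succ', mul_assoc, mul_assoc]
      exact (norm_mul_le _ _).trans (mul_le_mul hx4.le ih (norm_nonneg _) (by positivity))
  have hm : n % N < N := Nat.mod_lt n hN0
  have hsplit : S x ^ n = (S x ^ N) ^ (n / N) * S x ^ (n % N) := by
    rw [← pow_mul, ← pow_add, Nat.div_add_mod]
  have hρsplit : (ρ : ℝ) ^ n = ((ρ : ℝ) ^ N) ^ (n / N) * (ρ : ℝ) ^ (n % N) := by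
    rw [← pow_mul, ← pow_add, Nat.div_add_mod]
  rw [hsplit, hρsplit]
  refine (hmul _ _).trans ?_
  have h6 : ‖S x ^ (n % N)‖ ≤
      (∑ m ∈ range N, (‖S x₀ ^ m‖ + 1) / (ρ : ℝ) ^ m) * (ρ : ℝ) ^ (n % N) := by
    rw [← div_le_iff₀ (by positivity)]
    refine le_trans ?_ (single_le_sum (f := fun m => (‖S x₀ ^ m‖ + 1) / (ρ : ℝ) ^ m)
      (fun m _ => by positivity) (mem_range.2 hm))
    exact div_le_div_of_nonneg_right (hx5 _ (mem_range.2 hm)).le (by positivity)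
  calc ((ρ : ℝ) ^ N) ^ (n / N) * ‖S x ^ (n % N)‖
      ≤ ((ρ : ℝ) ^ N) ^ (n / N) * ((∑ m ∈ range N, (‖S x₀ ^ m‖ + 1) / (ρ : ℝ) ^ m)
          * (ρ : ℝ) ^ (n % N)) := mul_le_mul_of_nonneg_left h6 (by positivity)
    _ = _ := by ring

variable {ι : Type*} [Fintype ι] [DecidableEq ι]

theorem spectralRadius_lt_of_eigenvalues [Nonempty ι] {S : Matrix ι ι ℂ} {r : ℝ}
    (hS : ∀ μ : ℂ, ∀ w : ι → ℂ, w ≠ 0 → S *ᵥ w = μ • w → ‖μ‖ < r) :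
    ∃ ρ : ℝ≥0, 0 < ρ ∧ (ρ : ℝ) < r ∧ spectralRadius ℂ S < ρ := by
  have hr : 0 ≤ r := by
    obtain ⟨μ, hμ⟩ := spectrum.nonempty S
    obtain ⟨w, hw0, hw⟩ := mem_spectrum_iff_exists.1 hμ
    exact (norm_nonneg _).trans (hS μ w hw0 hw).le
  lift r to ℝ≥0 using hr
  have h1 : spectralRadius ℂ S < (r : ℝ≥0∞) := by
    refine spectrum.spectralRadius_lt_of_forall_lt S fun μ hμ => ?_
    obtain ⟨w, hw0, hw⟩ := mem_spectrum_iff_exists.1 hμ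
    exact hS μ w hw0 hw
  obtain ⟨ρ, h2, h3⟩ := ENNReal.lt_iff_exists_nnreal_btwn.1 h1
  exact ⟨ρ, by exact_mod_cast lt_of_le_of_lt zero_le h2, by exact_mod_cast h3, h2⟩

end PowerBound

/-! ### Analytic splitting along a simple dominant eigenvalue -/

section Splitting

variable {ι : Type*} [Fintype ι] [DecidableEq ι]

/-- The divided difference `(p(x) - p(u)) / (x - u)` of a polynomial, evaluated at a matrix `T`. -/
noncomputable def divDiff (p : ℂ[X]) (N : ℕ) (T : Matrix ι ι ℂ) (u : ℂ) : Matrix ι ι ℂ :=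
  ∑ k ∈ range N, p.coeff k • ∑ i ∈ range k, T ^ i * (u • (1 : Matrix ι ι ℂ)) ^ (k - 1 - i)

theorem commute_divDiff (p : ℂ[X]) (N : ℕ) (T : Matrix ι ι ℂ) (u : ℂ) :
    Commute T (divDiff p N T u) := by
  refine Commute.sum_right _ _ _ fun k _ => Commute.smul_right (Commute.sum_right _ _ _ fun i _ =>
    ((Commute.refl T).pow_right i).mul_right (Commute.pow_right ?_ _)) _
  exact (Commute.one_right T).smul_right u

theorem divDiff_mul_sub (p : ℂ[X]) {N : ℕ} (hN : p.natDegree < N) (T : Matrix ι ι ℂ) (u : ℂ) :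
    divDiff p N T u * (T - u • 1) = aeval T p - p.eval u • (1 : Matrix ι ι ℂ) := by
  rw [aeval_eq_sum_range' hN, eval_eq_sum_range' hN, sum_smul, ← sum_sub_distrib, divDiff, sum_mul]
  refine sum_congr rfl fun k _ => ?_
  rw [smul_mul_assoc, Commute.geom_sum₂_mul ((Commute.one_right T).smul_right u), smul_sub,
    _root_.smul_pow, one_pow, smul_smul]

theorem divDiff_mulVec (p : ℂ[X]) {N : ℕ} (hN : p.natDegree < N) {T : Matrix ι ι ℂ} {u : ℂ}
    {w : ι → ℂ} (hw : T *ᵥ w = u • w) : divDiff p N T u *ᵥ w = p.derivative.eval u • w := by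
  rw [divDiff, sum_mulVec, Polynomial.derivative_eval, Polynomial.sum_over_range' _ _ N hN, sum_smul]
  · refine sum_congr rfl fun k _ => ?_
    rw [smul_mulVec, sum_mulVec]
    have : ∀ i ∈ range k, (T ^ i * (u • (1 : Matrix ι ι ℂ)) ^ (k - 1 - i)) *ᵥ w
        = u ^ (k - 1) • w := by
      intro i hi
      have hi := mem_range.1 hi
      rw [_root_.smul_pow, one_pow, ← mulVec_mulVec, smul_mulVec, one_mulVec, mulVec_smul,
        pow_mulVec_eq hw, smul_smul, ← pow_add]
      congr 2
      omega
    rw [sum_congr rfl this, sum_const, card_range, ← Nat.cast_smul_eq_nsmul ℂ, smul_smul, smul_smul,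
      mul_assoc]
  · simp

/-- Each coefficient is a fixed polynomial in the matrix entries, given by the universal
characteristic polynomial. -/
theorem analyticAt_charpoly_coeff {T : ℂ → Matrix ι ι ℂ} {z₀ : ℂ}
    (hT : ∀ i j, AnalyticAt ℂ (fun z => T z i j) z₀) (k : ℕ) :
    AnalyticAt ℂ (fun z => (T z).charpoly.coeff k) z₀ := by
  have h := AnalyticAt.aeval_mvPolynomial (𝕜 := ℂ) (B := ℂ) (f := fun z (p : ι × ι) => T z p.1 p.2)
    (z := z₀) (fun p => hT p.1 p.2) ((Matrix.charpoly.univ ℂ ι).coeff k)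
  refine h.congr (Eventually.of_forall fun z => ?_)
  exact Matrix.charpoly.univ_coeff_eval₂Hom ι (algebraMap ℂ ℂ) (fun p => T z p.1 p.2) k

/-- The relations give $P(T-uP)=0$, so the mixed terms vanish. Exponent $0$ is excluded: there the
right side would be $P+1$. -/
theorem pow_succ_eq_of_projection {R A : Type*} [CommRing R] [Ring A] [Algebra R A]
    {T P : A} {u : R} (hTP : T * P = u • P)
    (hPT : P * T = u • P) (hPP : P * P = P) (n : ℕ) :
    T ^ (n + 1) = u ^ (n + 1) • P + (T - u • P) ^ (n + 1) := by
  have hPS : P * (T - u • P) = 0 := by rw [mul_sub, hPT, mul_smul_comm, hPP, sub_self]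
  induction n with
  | zero => simp
  | succ n ih =>
    have h1 : T * (T - u • P) ^ (n + 1) = (T - u • P) ^ (n + 2) := by
      have : P * (T - u • P) ^ (n + 1) = 0 := by rw [pow_succ', ← mul_assoc, hPS, zero_mul]
      rw [pow_succ' _ (n + 1), sub_mul, smul_mul_assoc, this, smul_zero, sub_zero]
    rw [pow_succ' T (n + 1), ih, mul_add, h1, mul_smul_comm, hTP, smul_smul, ← pow_succ]

/-- Splitting of the powers of an analytic matrix family along a simple dominant eigenvalue. -/
theorem exists_spectral_splitting [Nonempty ι] {T : ℂ → Matrix ι ι ℂ} {u : ℂ → ℂ}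
    (hT : AnalyticAt ℂ T 0) (hTe : ∀ i j, AnalyticAt ℂ (fun z => T z i j) 0)
    (hu : AnalyticAt ℂ u 0) (hroot : ∀ᶠ z in 𝓝 (0 : ℂ), (T z).charpoly.IsRoot (u z))
    (hsimple : (T 0).charpoly.derivative.eval (u 0) ≠ 0) (hu0 : u 0 ≠ 0)
    (hgap : ∀ μ : ℂ, ∀ w : ι → ℂ, w ≠ 0 → T 0 *ᵥ w = μ • w → μ = u 0 ∨ ‖μ‖ < ‖u 0‖) :
    ∃ P : ℂ → Matrix ι ι ℂ, AnalyticAt ℂ P 0 ∧ (∀ᶠ z in 𝓝 (0 : ℂ), T z * P z = u z • P z) ∧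
      (∀ w, T 0 *ᵥ w = u 0 • w → P 0 *ᵥ w = w) ∧
      ∃ ρ C : ℝ, 0 < ρ ∧ ρ < ‖u 0‖ ∧ 0 ≤ C ∧
        ∀ᶠ z in 𝓝 (0 : ℂ), ∀ n : ℕ, ‖T z ^ n - u z ^ n • P z‖ ≤ C * ρ ^ n := by
  set N := Fintype.card ι + 1 with hNdef
  have hN : ∀ z, (T z).charpoly.natDegree < N := fun z => by
    rw [Matrix.charpoly_natDegree_eq_dim]; omega
  set d : ℂ → ℂ := fun z => (T z).charpoly.derivative.eval (u z) with hd
  have hd_an : AnalyticAt ℂ d 0 := by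
    have : d = fun z => ∑ k ∈ range N, (T z).charpoly.coeff k * k * u z ^ (k - 1) := by
      funext z
      simp only [hd]
      rw [Polynomial.derivative_eval, Polynomial.sum_over_range' _ _ N (hN z)]
      simp
    rw [this]
    refine Finset.analyticAt_fun_sum _ fun k _ => ?_
    exact ((analyticAt_charpoly_coeff hTe k).mul analyticAt_const).mul (hu.pow _)
  set D : ℂ → Matrix ι ι ℂ := fun z => divDiff (T z).charpoly N (T z) (u z) with hD
  have hD_an : AnalyticAt ℂ D 0 := by
    refine Finset.analyticAt_fun_sum _ fun k _ => (analyticAt_charpoly_coeff hTe k).smul ?_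
    refine Finset.analyticAt_fun_sum _ fun i _ => (hT.pow i).mul (AnalyticAt.pow ?_ _)
    exact hu.smul analyticAt_const
  -- By Cayley–Hamilton the divided difference `D` of the characteristic polynomial annihilates
  -- $T-u$, and it acts on eigenvectors for `u` as multiplication by `d`. Dividing by `d` therefore
  -- gives the spectral projection, visibly analytic and obtained without contour integrals.
  set P : ℂ → Matrix ι ι ℂ := fun z => (d z)⁻¹ • D z with hP
  have hP_an : AnalyticAt ℂ P 0 := (hd_an.inv hsimple).smul hD_an
  have hcomm : ∀ z, Commute (T z) (P z) := fun z => (commute_divDiff _ N (T z) (u z)).smul_right _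
  have hPT : ∀ z, (T z).charpoly.IsRoot (u z) → P z * T z = u z • P z := by
    intro z hz
    have h1 := divDiff_mul_sub (T z).charpoly (hN z) (T z) (u z)
    rw [Matrix.aeval_self_charpoly, hz, zero_smul, sub_zero, mul_sub, sub_eq_zero, mul_smul_comm,
      mul_one] at h1
    simp only [hP, hD, smul_mul_assoc, h1]
    rw [smul_comm]
  have hPw : ∀ z, d z ≠ 0 → ∀ w, T z *ᵥ w = u z • w → P z *ᵥ w = w := by
    intro z hz w hw
    simp only [hP, hD]
    rw [smul_mulVec, divDiff_mulVec _ (hN z) hw, smul_smul, inv_mul_cancel₀ hz, one_smul]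
  have hPP : ∀ z, d z ≠ 0 → (T z).charpoly.IsRoot (u z) → P z * P z = P z := by
    intro z hz hz'
    refine Matrix.mulVec_injective (funext fun w => ?_)
    change (P z * P z) *ᵥ w = P z *ᵥ w
    rw [← mulVec_mulVec]
    refine hPw z hz _ ?_
    rw [mulVec_mulVec, (hcomm z).eq, hPT z hz', smul_mulVec]
  have hdne : ∀ᶠ z in 𝓝 (0 : ℂ), d z ≠ 0 := hd_an.continuousAt.eventually_ne hsimple
  set S : ℂ → Matrix ι ι ℂ := fun z => T z - u z • P z with hS
  have hroot0 := hroot.self_of_nhds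
  have hSc : ContinuousAt S 0 := (hT.sub (hu.smul hP_an)).continuousAt
  -- An eigenvector of $T-uP$ with nonzero eigenvalue is killed by `P`, hence is an eigenvector of
  -- `T`. The eigenvalue $u(0)$ itself is impossible, since `P` fixes its eigenvectors.
  obtain ⟨ρ, hρ0, hρ, hSρ⟩ := spectralRadius_lt_of_eigenvalues (S := S 0) (r := ‖u 0‖) (by
    intro μ w hw0 hw
    by_cases hμ : μ = 0
    · rw [hμ, norm_zero]; exact norm_pos_iff.2 hu0
    have hPS : P 0 * S 0 = 0 := by
      simp only [hS]
      rw [mul_sub, hPT 0 hroot0, mul_smul_comm, hPP 0 hsimple hroot0, sub_self]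
    have hPw0 : P 0 *ᵥ w = 0 := by
      have h1 : (P 0 * S 0) *ᵥ w = μ • (P 0 *ᵥ w) := by rw [← mulVec_mulVec, hw, mulVec_smul]
      rw [hPS, zero_mulVec] at h1
      exact (smul_eq_zero.1 h1.symm).resolve_left hμ
    have hTw : T 0 *ᵥ w = μ • w := by
      rw [← hw]
      simp only [hS]
      rw [sub_mulVec, smul_mulVec, hPw0, smul_zero, sub_zero]
    rcases hgap μ w hw0 hTw with h2 | h2
    · rw [h2] at hTw
      exact absurd ((hPw 0 hsimple w hTw).symm.trans hPw0) hw0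
    · exact h2)
  obtain ⟨C, hC0, hC⟩ := eventually_norm_pow_le hSc hSρ
  -- The summand $\|1-P(0)\|+1$ covers $n=0$, where the difference is $1-P(z)$ and not a power of
  -- $T-uP$.
  refine ⟨P, hP_an, ?_, hPw 0 hsimple, ρ, C + (‖1 - P 0‖ + 1), hρ0, hρ, by positivity, ?_⟩
  · filter_upwards [hroot] with z hz
    rw [(hcomm z).eq, hPT z hz]
  have h1P : ∀ᶠ z in 𝓝 (0 : ℂ), ‖1 - P z‖ < ‖1 - P 0‖ + 1 :=
    (continuousAt_const.sub hP_an.continuousAt).norm.eventually_lt_const (lt_add_one _)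
  filter_upwards [hC, hroot, hdne, h1P] with z hCz hrz hdz h1z n
  cases n with
  | zero =>
    simp only [pow_zero, one_smul, mul_one]
    linarith
  | succ n =>
    rw [pow_succ_eq_of_projection ((hcomm z).eq.trans (hPT z hrz)) (hPT z hrz) (hPP z hdz hrz),
      add_sub_cancel_left]
    refine (hCz (n + 1)).trans (mul_le_mul_of_nonneg_right ?_ (by positivity))
    have := norm_nonneg (1 - P 0)
    linarith

end Splitting

end SymbolStat

end

section

open Matrix Finset Complex Filter Polynomial
open scoped Topology NNReal ENNReal ContDiff Matrix.Norms.Operator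

namespace SymbolStat

/-! ### The variance as a sum of squares -/

section Variance

variable {ι : Type*} [Fintype ι] [DecidableEq ι]

theorem PerronTriple.exists_normalized [Nonempty ι] {M : Matrix ι ι ℝ} (hM : M.IsPrimitive) :
    ∃ r v l, PerronTriple M r v l ∧ l ⬝ᵥ v = 1 := by
  obtain ⟨r, v, l, h⟩ := exists_perronTriple hM
  have hpos := dotProduct_pos_of_pos h.v_pos h.l_pos
  refine ⟨r, v, (l ⬝ᵥ v)⁻¹ • l, ⟨h.r_pos, h.v_pos, fun i => ?_, h.mulVec_eq, ?_⟩, ?_⟩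
  · exact mul_pos (inv_pos.2 hpos) (h.l_pos i)
  · rw [smul_vecMul, h.vecMul_eq, smul_comm]
  · rw [smul_dotProduct, smul_eq_mul, inv_mul_cancel₀ hpos.ne']

/-- The quadratic form giving the asymptotic variance of the number of `a`-transitions. -/
theorem PerronTriple.variance_identity {A B : Matrix ι ι ℝ} {r : ℝ} {v l : ι → ℝ}
    (h : PerronTriple (A + B) r v l) (hlv : l ⬝ᵥ v = 1) {x : ι → ℝ} {b : ℝ}
    (hx : ∀ i, ∑ j, A i j * v j + ∑ j, (A i j + B i j) * x j = b * v i + r * x i) :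
    ∑ i, ∑ j, l i * v j * (A i j * (1 - b / r + x j / v j - x i / v i) ^ 2 +
        B i j * (-(b / r) + x j / v j - x i / v i) ^ 2) =
      ∑ i, l i * ∑ j, A i j * (v j + 2 * x j) - 2 * b * ∑ i, l i * x i - b ^ 2 / r := by
  have hr := h.r_pos.ne'
  have hvne : ∀ j, v j ≠ 0 := fun j => (h.v_pos j).ne'
  have hrow : ∀ i, ∑ j, l i * v j * (A i j * (1 - b / r + x j / v j - x i / v i) ^ 2 +
      B i j * (-(b / r) + x j / v j - x i / v i) ^ 2) =
      l i * ∑ j, (A i j + B i j) * (x j ^ 2 / v j) - r * (l i * (x i ^ 2 / v i)) +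
        (l i * ∑ j, A i j * (v j + 2 * x j) - 2 * b * (l i * x i) - b ^ 2 / r * (l i * v i)) := by
    intro i
    have h1 : ∑ j, (A i j + B i j) * v j = r * v i := congrFun h.mulVec_eq i
    have h2 := hx i
    have h3 : ∑ j, l i * v j * (A i j * (1 - b / r + x j / v j - x i / v i) ^ 2 +
        B i j * (-(b / r) + x j / v j - x i / v i) ^ 2) =
        l i * (∑ j, (A i j + B i j) * (x j ^ 2 / v j)
          + (x i / v i + b / r) ^ 2 * ∑ j, (A i j + B i j) * v j
          - 2 * (x i / v i + b / r) * ∑ j, (A i j + B i j) * x j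
          + (- 2 * (b / r) - 2 * (x i / v i)) * ∑ j, A i j * v j
          + ∑ j, A i j * (v j + 2 * x j)) := by
      simp only [mul_sum, ← sum_add_distrib, ← sum_sub_distrib]
      refine sum_congr rfl fun j _ => ?_
      have := hvne j
      generalize x i / v i = y
      field_simp
      ring
    have h4 : ∑ j, (A i j + B i j) * x j = b * v i + r * x i - ∑ j, A i j * v j := by linarith
    rw [h3, h1, h4]
    have := hvne i
    field_simp
    ring
  -- Since `l` is a left eigenvector, the terms quadratic in `x` that remain in the row identities
  -- cancel after summation over `i`.
  have hN : ∑ i, l i * ∑ j, (A i j + B i j) * (x j ^ 2 / v j) = ∑ i, r * (l i * (x i ^ 2 / v i)) := by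
    have := h.dotProduct_mulVec_eq fun j => x j ^ 2 / v j
    simpa only [dotProduct, mulVec, Matrix.add_apply, mul_sum] using this
  have hlv' : ∑ i, l i * v i = 1 := hlv
  rw [sum_congr rfl fun i _ => hrow i, sum_add_distrib, sum_sub_distrib, hN, sub_self, zero_add,
    sum_sub_distrib, sum_sub_distrib, ← mul_sum, ← mul_sum, hlv', mul_one]

end Variance

/-! ### The implicit eigenvalue, its derivatives, and positivity of the variance -/

namespace LinRep

/-- If each edge's centred letter count is a difference of potentials, the contributions telescope
along a walk; on a cycle the letter count is thus `b` times the length. -/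
theorem IsWalk.potential {ι : Type} {R : LinRep ι} {g : ι → ℝ} {b : ℝ}
    (hA : ∀ i j, 0 < R.A i j → 1 - b + g j - g i = 0)
    (hB : ∀ i j, 0 < R.B i j → -b + g j - g i = 0) {i j : ι} {w : List Letter}
    (hw : R.IsWalk i j w) : (w.count Letter.a : ℝ) - b * w.length + g j - g i = 0 := by
  induction hw with
  | nil i => simp
  | @cons i j k w c hc p ih =>
    cases c with
    | a =>
      have := hA i j hc
      rw [List.count_cons_self, List.length_cons]
      push_cast
      linarith
    | b =>
      have := hB i j hc
      rw [List.count_cons_of_ne (by decide), List.length_cons]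
      push_cast
      linarith

variable {ι : Type} [Fintype ι] [DecidableEq ι] (R : LinRep ι)

theorem expMatrix_zero : R.expMatrix 0 = R.M.map (fun x : ℝ => (x : ℂ)) := by
  ext i j
  simp [expMatrix, M]

theorem expMatrix_apply (z : ℂ) (i j : ι) :
    R.expMatrix z i j = Complex.exp z * R.A i j + R.B i j := by
  simp [expMatrix]

theorem analyticAt_expMatrix (z : ℂ) : AnalyticAt ℂ R.expMatrix z := by
  have : AnalyticAt ℂ (fun z : ℂ => Complex.exp z • R.A.map (fun x : ℝ => (x : ℂ)) +
      R.B.map (fun x : ℝ => (x : ℂ))) z :=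
    (analyticAt_cexp.smul analyticAt_const).add analyticAt_const
  exact this

theorem analyticAt_expMatrix_apply (z : ℂ) (i j : ι) :
    AnalyticAt ℂ (fun z => R.expMatrix z i j) z := by
  simp only [expMatrix_apply]
  exact (analyticAt_cexp.mul analyticAt_const).add analyticAt_const

theorem det_smul_one_sub (T : Matrix ι ι ℂ) (x : ℂ) :
    (x • (1 : Matrix ι ι ℂ) - T).det = T.charpoly.eval x := by
  rw [Matrix.eval_charpoly, show scalar ι x = x • (1 : Matrix ι ι ℂ) from
    Algebra.algebraMap_eq_smul_one x]

/-- Implicit function theorem: the partial derivative of the determinant in the second variable is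
the derivative of the characteristic polynomial, nonzero at a simple root. -/
theorem exists_isImplicitRoot (hroot : (R.expMatrix 0).charpoly.IsRoot (R.perron : ℂ))
    (hsimple : (R.expMatrix 0).charpoly.derivative.eval (R.perron : ℂ) ≠ 0) :
    ∃ u, R.IsImplicitRoot u := by
  set f : ℂ × ℂ → ℂ := fun p => (p.2 • (1 : Matrix ι ι ℂ) - R.expMatrix p.1).det with hf
  have hfc : ContDiff ℂ ω f := by
    have : f = fun p => ∑ σ : Equiv.Perm ι, ((Equiv.Perm.sign σ : ℤ) : ℂ) *
        ∏ i, (p.2 * (1 : Matrix ι ι ℂ) (σ i) i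
          - (Complex.exp p.1 * R.A (σ i) i + R.B (σ i) i)) := by
      funext p
      simp only [hf, Matrix.det_apply', Matrix.sub_apply, Matrix.smul_apply, smul_eq_mul,
        expMatrix_apply]
    rw [this]
    refine ContDiff.sum fun σ _ => contDiff_const.mul (contDiff_prod fun i _ => ?_)
    exact (contDiff_snd.mul contDiff_const).sub
      (((Complex.contDiff_exp.comp contDiff_fst).mul contDiff_const).add contDiff_const)
  have hfa : ContDiffAt ℂ ω f (0, (R.perron : ℂ)) := hfc.contDiffAt
  have hne : (ω : ℕ∞ω) ≠ 0 := by simp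
  have hf0 : f (0, (R.perron : ℂ)) = 0 := by
    simp only [hf, det_smul_one_sub]
    exact hroot
  set c := (R.expMatrix 0).charpoly.derivative.eval (R.perron : ℂ) with hc
  have hL : (fderiv ℂ f (0, (R.perron : ℂ)) ∘L .inr ℂ ℂ ℂ) 1 = c := by
    have h1 : HasFDerivAt f (fderiv ℂ f (0, (R.perron : ℂ))) (0, (R.perron : ℂ)) :=
      (hfa.differentiableAt hne).hasFDerivAt
    have h2 : HasDerivAt (fun x : ℂ => ((0 : ℂ), x)) ((0 : ℂ), (1 : ℂ)) (R.perron : ℂ) :=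
      (hasDerivAt_const _ _).prodMk (hasDerivAt_id _)
    have h3 := h1.comp_hasDerivAt (R.perron : ℂ) h2
    have h4 : HasDerivAt (fun x : ℂ => (R.expMatrix 0).charpoly.eval x) c (R.perron : ℂ) :=
      Polynomial.hasDerivAt _ _
    have h5 : (f ∘ fun x : ℂ => ((0 : ℂ), x)) = fun x : ℂ => (R.expMatrix 0).charpoly.eval x := by
      funext x
      simp only [hf, Function.comp, det_smul_one_sub]
    rw [h5] at h3
    exact h3.unique h4
  have hinv : (fderiv ℂ f (0, (R.perron : ℂ)) ∘L .inr ℂ ℂ ℂ).IsInvertible := by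
    refine ⟨ContinuousLinearEquiv.unitsEquivAut ℂ (Units.mk0 c hsimple), ?_⟩
    ext
    rw [hL]
    simp
  refine ⟨hfa.implicitFunction hne hinv, ?_, ?_, ?_⟩
  · exact (hfa.contDiffAt_implicitFunction hne hinv).analyticAt
  · exact hfa.implicitFunction_apply_self hne hinv
  · have := hfa.eventually_apply_implicitFunction hne hinv
    simpa only [hf0] using this

variable {R}

theorem IsImplicitRoot.eventually_isRoot {u : ℂ → ℂ} (hu : R.IsImplicitRoot u) :
    ∀ᶠ z in 𝓝 (0 : ℂ), (R.expMatrix z).charpoly.IsRoot (u z) := by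
  filter_upwards [hu.det_eq_zero] with z hz
  rwa [det_smul_one_sub] at hz

section Primitive

variable [Nonempty ι] {r : ℝ} {v l : ι → ℝ}

theorem perron_eq (h : PerronTriple R.M r v l) (hM : R.M.IsPrimitive) : R.perron = r := by
  rw [perron, h.spectralRadius_eq hM, ENNReal.toReal_ofReal h.r_pos.le]

theorem expMatrix_zero_mulVec (h : PerronTriple R.M r v l) :
    R.expMatrix 0 *ᵥ (fun i => (v i : ℂ)) = (r : ℂ) • fun i => (v i : ℂ) := by
  rw [expMatrix_zero]
  ext i
  have := congrFun h.mulVec_eq i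
  simp only [mulVec, dotProduct, map_apply, Pi.smul_apply, smul_eq_mul] at this ⊢
  exact_mod_cast this

theorem isImplicitRoot_implicitRoot (hM : R.M.IsPrimitive) :
    R.IsImplicitRoot R.implicitRoot := by
  obtain ⟨r, v, l, h⟩ := exists_perronTriple hM
  refine Classical.epsilon_spec (R.exists_isImplicitRoot ?_ ?_)
  · rw [perron_eq h hM]
    refine isRoot_charpoly_iff.2 ⟨fun i => (v i : ℂ), fun h0 => ?_, expMatrix_zero_mulVec h⟩
    obtain ⟨i⟩ := ‹Nonempty ι›
    exact (h.v_pos i).ne' (by simpa using congrFun h0 i)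
  · rw [perron_eq h hM, expMatrix_zero]
    exact h.derivative_charpoly_ne_zero hM

/-- The first two derivatives of the implicit root in terms of the derivative `G` of an analytic
eigenvector. -/
theorem IsImplicitRoot.exists_derivatives {u : ℂ → ℂ} (hu : R.IsImplicitRoot u)
    (h : PerronTriple R.M r v l) (hlv : l ⬝ᵥ v = 1) (hM : R.M.IsPrimitive) :
    ∃ G : ι → ℂ,
      (∀ i, ∑ j, (R.A i j : ℂ) * v j + ∑ j, ((R.A i j : ℂ) + R.B i j) * G j
        = deriv u 0 * v i + r * G i) ∧
      iteratedDeriv 2 u 0 = ∑ i, (l i : ℂ) * ∑ j, (R.A i j : ℂ) * (v j + 2 * G j)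
        - 2 * deriv u 0 * ∑ i, (l i : ℂ) * G i := by
  have hu0 : u 0 = r := by rw [hu.map_zero, perron_eq h hM]
  have hr : (r : ℂ) ≠ 0 := by exact_mod_cast h.r_pos.ne'
  obtain ⟨P, hP, hTP, hPv, -⟩ := exists_spectral_splitting (T := R.expMatrix) (u := u)
    (R.analyticAt_expMatrix 0) (fun i j => R.analyticAt_expMatrix_apply 0 i j) hu.analytic
    hu.eventually_isRoot
    (by rw [hu0, expMatrix_zero]; exact h.derivative_charpoly_ne_zero hM) (by rwa [hu0])
    (by
      intro μ w hw0 hw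
      rw [hu0, Complex.norm_real, Real.norm_of_nonneg h.r_pos.le]
      rw [expMatrix_zero] at hw
      exact h.eigenvalue_eq_or_lt hM hw0 hw)
  -- Projecting the fixed vector `v` by $P(z)$ gives an analytic family of eigenvectors starting at
  -- `v`; its derivative at $0$ is the required `G`.
  set V : ι → ℂ → ℂ := fun i z => (P z *ᵥ fun i => (v i : ℂ)) i with hVdef
  have hV : ∀ i, AnalyticAt ℂ (V i) 0 := by
    intro i
    let L : Matrix ι ι ℂ →ₗ[ℂ] ℂ :=
      { toFun := fun Q => (Q *ᵥ fun i => (v i : ℂ)) i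
        map_add' := fun Q Q' => by simp [add_mulVec]
        map_smul' := fun c Q => by simp [smul_mulVec] }
    exact (L.toContinuousLinearMap.analyticAt _).comp hP
  have hV0 : ∀ i, V i 0 = v i := by
    have := hPv (fun i => (v i : ℂ)) (by rw [hu0]; exact expMatrix_zero_mulVec h)
    exact fun i => congrFun this i
  have hTV : ∀ᶠ z in 𝓝 (0 : ℂ), ∀ i,
      ∑ j, (Complex.exp z * R.A i j + R.B i j) * V j z = u z * V i z := by
    filter_upwards [hTP] with z hz i
    have := congrArg (fun Q : Matrix ι ι ℂ => (Q *ᵥ fun i => (v i : ℂ)) i) hz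
    simp only [← mulVec_mulVec, smul_mulVec] at this
    simpa [mulVec, dotProduct, expMatrix_apply, V] using this
  have hVd : ∀ i, HasDerivAt (V i) (deriv (V i) 0) 0 := fun i =>
    (hV i).differentiableAt.hasDerivAt
  have hud : HasDerivAt u (deriv u 0) 0 := hu.analytic.differentiableAt.hasDerivAt
  refine ⟨fun i => deriv (V i) 0, fun i => ?_, ?_⟩
  · have h1 : HasDerivAt (fun z => ∑ j, (Complex.exp z * R.A i j + R.B i j) * V j z)
        (∑ j, ((R.A i j : ℂ) * v j + ((R.A i j : ℂ) + R.B i j) * deriv (V j) 0)) 0 := by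
      refine HasDerivAt.fun_sum fun j _ => ?_
      have h2 := (((Complex.hasDerivAt_exp 0).mul_const (R.A i j : ℂ)).add_const
        (R.B i j : ℂ)).fun_mul (hVd j)
      simpa [hV0] using h2
    have h3 : HasDerivAt (fun z => u z * V i z) (deriv u 0 * v i + r * deriv (V i) 0) 0 := by
      have := hud.mul (hVd i)
      rwa [hu0, hV0] at this
    have h4 := h3.congr_of_eventuallyEq (f₁ := fun z => ∑ j,
      (Complex.exp z * R.A i j + R.B i j) * V j z) (by filter_upwards [hTV] with z hz using hz i)
    rw [← sum_add_distrib]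
    exact h1.unique h4
  · set a : ℂ → ℂ := fun z => ∑ i, (l i : ℂ) * ∑ j, (R.A i j : ℂ) * V j z with ha
    set m : ℂ → ℂ := fun z => ∑ i, (l i : ℂ) * V i z with hm
    have ha_an : AnalyticAt ℂ a 0 := Finset.analyticAt_fun_sum _ fun i _ =>
      analyticAt_const.mul (Finset.analyticAt_fun_sum _ fun j _ => analyticAt_const.mul (hV j))
    have hm_an : AnalyticAt ℂ m 0 := Finset.analyticAt_fun_sum _ fun i _ =>
      analyticAt_const.mul (hV i)
    have ha' : deriv a 0 = ∑ i, (l i : ℂ) * ∑ j, (R.A i j : ℂ) * deriv (V j) 0 :=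
      (HasDerivAt.fun_sum fun i _ => (HasDerivAt.fun_sum fun j _ =>
        (hVd j).const_mul _).const_mul _).deriv
    have hm' : deriv m 0 = ∑ i, (l i : ℂ) * deriv (V i) 0 :=
      (HasDerivAt.fun_sum fun i _ => (hVd i).const_mul _).deriv
    have hm0 : m 0 = 1 := by
      simp only [hm, hV0]
      exact_mod_cast hlv
    -- Pairing the eigenvector equation with `l` and using $l(A+B)=rl$ leaves a scalar identity in
    -- which both sides have a factor vanishing at $0$. Its second derivative at $0$ therefore never
    -- involves the second derivative of `V`.
    have heq : (fun z => (Complex.exp z - 1) * a z) =ᶠ[𝓝 0] fun z => (u z - r) * m z := by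
      filter_upwards [hTV] with z hz
      have h1 : ∑ i, (l i : ℂ) * ∑ j, ((R.A i j : ℂ) + R.B i j) * V j z = r * m z := by
        simp only [mul_sum, hm]
        rw [sum_comm]
        refine sum_congr rfl fun j _ => ?_
        have h2 : ∑ i, l i * (R.A i j + R.B i j) = r * l j := congrFun h.vecMul_eq j
        have h3 : ∑ i, (l i : ℂ) * ((R.A i j : ℂ) + R.B i j) = r * l j := by exact_mod_cast h2
        rw [← mul_assoc, ← h3, sum_mul]
        exact sum_congr rfl fun i _ => by ring
      have h4 : ∑ i, (l i : ℂ) * ∑ j, (Complex.exp z * R.A i j + R.B i j) * V j z = u z * m z := by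
        simp only [hz, hm, mul_sum]
        exact sum_congr rfl fun i _ => by ring
      rw [sub_mul (u z), ← h4, ← h1]
      simp only [ha, mul_sum, ← sum_sub_distrib]
      exact sum_congr rfl fun i _ => sum_congr rfl fun j _ => by ring
    have h2 := heq.iteratedDeriv_eq 2
    have hexp : AnalyticAt ℂ (fun z => Complex.exp z - 1) 0 := analyticAt_cexp.sub analyticAt_const
    have hur : AnalyticAt ℂ (fun z => u z - r) 0 := hu.analytic.sub analyticAt_const
    rw [iteratedDeriv_fun_mul hexp.contDiffAt ha_an.contDiffAt,
      iteratedDeriv_fun_mul hur.contDiffAt hm_an.contDiffAt] at h2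
    have e1 : deriv (fun z : ℂ => Complex.exp z - 1) = Complex.exp := by
      funext z; simp
    have e2 : deriv (fun z : ℂ => u z - r) = deriv u := by
      funext z; simp
    have e3 : iteratedDeriv 2 (fun z : ℂ => Complex.exp z - 1) 0 = 1 := by
      rw [iteratedDeriv_succ', e1, iteratedDeriv_one]; simp
    have e4 : iteratedDeriv 2 (fun z : ℂ => u z - r) 0 = iteratedDeriv 2 u 0 := by
      rw [iteratedDeriv_succ', e2, ← iteratedDeriv_succ']
    simp only [sum_range_succ, range_zero, sum_empty, Nat.choose, iteratedDeriv_zero,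
      iteratedDeriv_one, e1, e2, e3, e4, hm0, hu0, Nat.sub_self] at h2
    norm_num at h2
    have ha0 : a 0 = ∑ i, (l i : ℂ) * ∑ j, (R.A i j : ℂ) * v j := by simp only [ha, hV0]
    have h5 : ∑ i, (l i : ℂ) * ∑ j, (R.A i j : ℂ) * (v j + 2 * deriv (V j) 0)
        = a 0 + 2 * deriv a 0 := by
      rw [ha0, ha']
      simp only [mul_sum, ← sum_add_distrib]
      exact sum_congr rfl fun i _ => sum_congr rfl fun j _ => by ring
    rw [h5, ← hm']
    linear_combination -h2

/-- The parameters `β` and `γ` of a primitive aperiodic representation. -/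
theorem exists_parameters (hM : R.M.IsPrimitive) (haper : R.IsAperiodic) :
    ∃ β γ : ℝ, R.beta = (β : ℂ) ∧ R.gamma = (γ : ℂ) ∧ 0 < γ := by
  obtain ⟨r, v, l, h, hlv⟩ := PerronTriple.exists_normalized hM
  obtain ⟨G, hG1, hG2⟩ := (isImplicitRoot_implicitRoot hM).exists_derivatives h hlv hM
  set u := R.implicitRoot
  have hr := h.r_pos
  set b : ℝ := ∑ i, l i * ∑ j, R.A i j * v j with hb
  have hlv' : ∑ i, l i * v i = 1 := hlv
  have hub : deriv u 0 = b := by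
    have h1 : ∑ i, (l i : ℂ) * (∑ j, (R.A i j : ℂ) * v j + ∑ j, ((R.A i j : ℂ) + R.B i j) * G j)
        = ∑ i, (l i : ℂ) * (deriv u 0 * v i + r * G i) :=
      sum_congr rfl fun i _ => by rw [hG1 i]
    have h2 : ∑ i, (l i : ℂ) * ∑ j, ((R.A i j : ℂ) + R.B i j) * G j = r * ∑ i, (l i : ℂ) * G i := by
      simp only [mul_sum]
      rw [sum_comm]
      refine sum_congr rfl fun j _ => ?_
      have h2 : ∑ i, l i * (R.A i j + R.B i j) = r * l j := congrFun h.vecMul_eq j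
      have h3 : ∑ i, (l i : ℂ) * ((R.A i j : ℂ) + R.B i j) = r * l j := by exact_mod_cast h2
      rw [← mul_assoc, ← h3, sum_mul]
      exact sum_congr rfl fun i _ => by ring
    have h3 : ∑ i, (l i : ℂ) * (deriv u 0 * v i + r * G i) =
        deriv u 0 * ∑ i, (l i : ℂ) * v i + r * ∑ i, (l i : ℂ) * G i := by
      simp only [mul_sum, ← sum_add_distrib]
      exact sum_congr rfl fun i _ => by ring
    have h4 : ∑ i, (l i : ℂ) * v i = 1 := by exact_mod_cast hlv'
    simp only [mul_add, sum_add_distrib] at h1 h3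
    rw [h2, h3, h4] at h1
    rw [hb]
    push_cast
    linear_combination -h1
  rw [hub] at hG1 hG2
  set x : ι → ℝ := fun i => (G i).re with hx
  have hxeq : ∀ i, ∑ j, R.A i j * v j + ∑ j, (R.A i j + R.B i j) * x j = b * v i + r * x i := by
    intro i
    have := congrArg Complex.re (hG1 i)
    simpa [Complex.re_sum] using this
  -- The imaginary part of `G` solves the homogeneous equation, so it is a multiple of `v`; its two
  -- contributions to the second derivative of `u` cancel.
  obtain ⟨c, hc⟩ : ∃ c : ℝ, (fun i => (G i).im) = c • v := by
    refine h.eq_smul_of_eigenvector hM (funext fun i => ?_)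
    have := congrArg Complex.im (hG1 i)
    simpa [Complex.im_sum, mulVec, dotProduct, M] using this
  have hGx : ∀ i, G i = x i + c * v i * Complex.I := fun i => by
    have h1 : (G i).im = c * v i := congrFun hc i
    refine Complex.ext ?_ ?_ <;> simp [hx, h1]
  set s : ℝ := ∑ i, l i * ∑ j, R.A i j * (v j + 2 * x j) - 2 * b * ∑ i, l i * x i with hs
  have hus : iteratedDeriv 2 u 0 = s := by
    have h1 : ∑ i, (l i : ℂ) * ∑ j, (R.A i j : ℂ) * (v j + 2 * G j) =
        ∑ i, (l i : ℂ) * ∑ j, (R.A i j : ℂ) * (v j + 2 * x j) + 2 * c * b * Complex.I := by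
      rw [hb]
      push_cast
      simp only [mul_sum, sum_mul, ← sum_add_distrib, hGx]
      exact sum_congr rfl fun i _ => sum_congr rfl fun j _ => by ring
    have h2 : ∑ i, (l i : ℂ) * G i = ∑ i, (l i : ℂ) * x i + c * Complex.I := by
      have h3 : ∑ i, (l i : ℂ) * v i = 1 := by exact_mod_cast hlv'
      have h4 : (c : ℂ) * Complex.I = c * Complex.I * ∑ i, (l i : ℂ) * v i := by rw [h3, mul_one]
      rw [h4]
      simp only [mul_sum, ← sum_add_distrib, hGx]
      exact sum_congr rfl fun i _ => by ring
    rw [hG2, h1, h2, hs]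
    push_cast
    ring
  refine ⟨b / r, s / r - (b / r) ^ 2, ?_, ?_, ?_⟩
  · rw [beta, hub, perron_eq h hM]; push_cast; rfl
  · rw [gamma, hub, hus, perron_eq h hM]; push_cast; rfl
  have hid := h.variance_identity (A := R.A) (B := R.B) hlv hxeq
  rw [← hs] at hid
  have hterm : ∀ i j, 0 ≤ l i * v j * (R.A i j * (1 - b / r + x j / v j - x i / v i) ^ 2 +
      R.B i j * (-(b / r) + x j / v j - x i / v i) ^ 2) := fun i j =>
    mul_nonneg (mul_nonneg (h.l_pos i).le (h.v_pos j).le) (add_nonneg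
      (mul_nonneg (R.A_nonneg i j) (sq_nonneg _)) (mul_nonneg (R.B_nonneg i j) (sq_nonneg _)))
  have hγ : s / r - (b / r) ^ 2 = (s - b ^ 2 / r) / r := by field_simp
  rw [hγ, ← hid]
  refine div_pos (lt_of_le_of_ne (sum_nonneg fun i _ => sum_nonneg fun j _ => hterm i j) ?_) hr
  intro h0
  have hzero : ∀ i j, R.A i j * (1 - b / r + x j / v j - x i / v i) ^ 2 = 0 ∧
      R.B i j * (-(b / r) + x j / v j - x i / v i) ^ 2 = 0 := by
    intro i j
    have h1 := (sum_eq_zero_iff_of_nonneg fun i _ => sum_nonneg fun j _ => hterm i j).1 h0.symm i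
      (mem_univ i)
    have h2 := (sum_eq_zero_iff_of_nonneg fun j _ => hterm i j).1 h1 j (mem_univ j)
    have h3 := (mul_eq_zero.1 h2).resolve_left (mul_pos (h.l_pos i) (h.v_pos j)).ne'
    exact (add_eq_zero_iff_of_nonneg (mul_nonneg (R.A_nonneg i j) (sq_nonneg _))
      (mul_nonneg (R.B_nonneg i j) (sq_nonneg _))).1 h3
  have hpot : ∀ {i j : ι} {w : List Letter}, R.IsWalk i j w →
      (w.count Letter.a : ℝ) - b / r * w.length + x j / v j - x i / v i = 0 := fun hw =>
    hw.potential (g := fun i => x i / v i)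
      (fun i j hij => pow_eq_zero_iff two_ne_zero |>.1
        ((mul_eq_zero.1 (hzero i j).1).resolve_left hij.ne'))
      (fun i j hij => pow_eq_zero_iff two_ne_zero |>.1
        ((mul_eq_zero.1 (hzero i j).2).resolve_left hij.ne'))
  -- Zero variance makes the ratios $x_i/v_i$ a potential, so cycles of equal length contain equally
  -- many $a$'s. All differences are $0$, and so would be their gcd.
  have hdvd : 0 ∣ Nat.setGcd R.cycleDifferences := by
    refine Nat.dvd_setGcd_iff.2 ?_
    rintro d ⟨i, j, w, w', hw, hw', hlen, rfl⟩
    have h1 := hpot hw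
    have h2 := hpot hw'
    rw [hlen] at h1
    have h3 : (w.count Letter.a : ℝ) = w'.count Letter.a := by linarith
    have h4 : w.count Letter.a = w'.count Letter.a := by exact_mod_cast h3
    rw [h4]
    simp
  rw [IsAperiodic] at haper
  rw [haper] at hdvd
  simp at hdvd

end Primitive

end LinRep

end SymbolStat

end

section

open Finset Complex Filter MeasureTheory
open scoped Topology Real

namespace SymbolStat

/-! ### Fourier inversion and the local limit estimate -/

section LocalLimit

theorem integral_exp_int_mul_I (m : ℤ) :
    ∫ θ in (-π)..π, cexp (m * θ * I) = if m = 0 then (2 * π : ℂ) else 0 := by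
  split_ifs with hm
  · simp only [hm, Int.cast_zero, zero_mul, Complex.exp_zero, intervalIntegral.integral_const,
      sub_neg_eq_add, Complex.real_smul, mul_one]
    push_cast; ring
  · have hc : (m : ℂ) * I ≠ 0 := mul_ne_zero (by exact_mod_cast hm) I_ne_zero
    have h1 : ∀ θ : ℝ, cexp (m * θ * I) = cexp (m * I * θ) := fun θ => by ring_nf
    simp only [h1]
    rw [integral_exp_mul_complex hc, div_eq_zero_iff]
    left
    rw [sub_eq_zero, Complex.exp_eq_exp_iff_exists_int]
    exact ⟨m, by push_cast; ring⟩

theorem integral_charFun_mul_exp (p : ℕ → ℝ) (n k : ℕ) (hk : k ≤ n) :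
    ∫ θ in (-π)..π, (∑ j ∈ range (n + 1), (p j : ℂ) * cexp (j * θ * I)) * cexp (-(k * θ * I))
      = 2 * π * p k := by
  have h1 : ∀ θ : ℝ, (∑ j ∈ range (n + 1), (p j : ℂ) * cexp (j * θ * I)) * cexp (-(k * θ * I))
      = ∑ j ∈ range (n + 1), (p j : ℂ) * cexp (((j : ℤ) - (k : ℤ) : ℤ) * θ * I) := by
    intro θ
    rw [sum_mul]
    refine sum_congr rfl fun j _ => ?_
    rw [mul_assoc, ← Complex.exp_add]
    push_cast
    ring_nf
  simp only [h1]
  rw [intervalIntegral.integral_finsetSum fun j _ => by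
    refine Continuous.intervalIntegrable ?_ _ _
    fun_prop]
  simp only [intervalIntegral.integral_const_mul, integral_exp_int_mul_I]
  rw [sum_eq_single k]
  · simp; ring
  · intro j _ hj
    rw [if_neg (by omega), mul_zero]
  · intro h
    exact absurd (mem_range.2 (by omega)) h

/-- Applied with `b` proportional to `n`, this first absolute moment is the source of the rate
$1/n$. -/
theorem integral_abs_mul_exp_neg_mul_sq {b : ℝ} (hb : 0 < b) :
    ∫ θ : ℝ, |θ| * Real.exp (-b * θ ^ 2) = 1 / b := by
  have h1 := integral_comp_abs (f := fun x : ℝ => x * Real.exp (-b * x ^ 2))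
  simp only [sq_abs] at h1
  rw [h1]
  have h2 := integral_mul_cexp_neg_mul_sq (b := (b : ℂ)) (by simpa using hb)
  have h3 : ∀ x : ℝ, (x : ℂ) * cexp (-(b : ℂ) * (x : ℂ) ^ 2)
      = ((x * Real.exp (-b * x ^ 2) : ℝ) : ℂ) := fun x => by push_cast; rfl
  simp only [h3] at h2
  rw [integral_complex_ofReal] at h2
  have h4 : ∫ x in Set.Ioi (0 : ℝ), x * Real.exp (-b * x ^ 2) = (2 * b)⁻¹ := by exact_mod_cast h2
  rw [h4]
  field_simp

theorem integrable_abs_mul_exp_neg_mul_sq {b : ℝ} (hb : 0 < b) :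
    Integrable fun θ : ℝ => |θ| * Real.exp (-b * θ ^ 2) := by
  have := (integrable_mul_exp_neg_mul_sq hb).norm
  simpa [abs_mul, Real.abs_exp] using this

/-- The characteristic function of the Gaussian law of mean `β n` and variance `γ n`. -/
noncomputable def gaussianChar (β γ : ℝ) (n : ℕ) (θ : ℝ) : ℂ :=
  cexp (n * (β * (θ * I) + γ / 2 * (θ * I) ^ 2))

theorem norm_gaussianChar (β γ : ℝ) (n : ℕ) (θ : ℝ) :
    ‖gaussianChar β γ n θ‖ = Real.exp (-(γ / 2 * n) * θ ^ 2) := by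
  have : (n : ℂ) * (β * (θ * I) + γ / 2 * (θ * I) ^ 2)
      = ((-(γ / 2 * n) * θ ^ 2 : ℝ) : ℂ) + ((n * β * θ : ℝ) : ℂ) * I := by
    push_cast
    rw [mul_pow, I_sq]
    ring
  rw [gaussianChar, Complex.norm_exp, this]
  simp only [add_re, ofReal_re, re_ofReal_mul, I_re, mul_zero, add_zero]

theorem continuous_gaussianChar (β γ : ℝ) (n : ℕ) : Continuous (gaussianChar β γ n) := by
  unfold gaussianChar
  fun_prop

theorem integrable_gaussianChar_mul (β : ℝ) {γ : ℝ} (hγ : 0 < γ) {n : ℕ} (hn : 0 < n) (k : ℕ) :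
    Integrable fun θ : ℝ => gaussianChar β γ n θ * cexp (-(k * θ * I)) := by
  have hb : 0 < γ / 2 * n := by positivity
  refine (integrable_exp_neg_mul_sq hb).mono'
    ((continuous_gaussianChar β γ n).mul (by fun_prop)).aestronglyMeasurable
    (Eventually.of_forall fun θ => ?_)
  rw [norm_mul, norm_gaussianChar]
  have : -((k : ℂ) * θ * I) = ((-(k * θ) : ℝ) : ℂ) * I := by push_cast; ring
  rw [this, Complex.norm_exp_ofReal_mul_I, mul_one]

theorem integral_gaussianChar_mul (β : ℝ) {γ : ℝ} (hγ : 0 < γ) {n : ℕ} (hn : 0 < n) (k : ℕ) :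
    ∫ θ : ℝ, gaussianChar β γ n θ * cexp (-(k * θ * I)) =
      ((√(2 * π / (γ * n)) * Real.exp (-((k - β * n) ^ 2 / (2 * γ * n))) : ℝ) : ℂ) := by
  have hb : 0 < γ / 2 * n := by positivity
  have h := fourierIntegral_gaussian (b := ((γ / 2 * n : ℝ) : ℂ)) (by simpa using hb)
    ((n * β - k : ℝ) : ℂ)
  have h1 : ∀ θ : ℝ, gaussianChar β γ n θ * cexp (-(k * θ * I)) =
      cexp (I * ((n * β - k : ℝ) : ℂ) * θ) * cexp (-((γ / 2 * n : ℝ) : ℂ) * (θ : ℂ) ^ 2) := by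
    intro θ
    rw [gaussianChar, ← Complex.exp_add, ← Complex.exp_add, mul_pow, I_sq]
    push_cast
    ring_nf
  simp only [h1]
  rw [h]
  have h2 : (π : ℂ) / ((γ / 2 * n : ℝ) : ℂ) = ((2 * π / (γ * n) : ℝ) : ℂ) := by
    have : (γ : ℂ) ≠ 0 := by exact_mod_cast hγ.ne'
    have : (n : ℂ) ≠ 0 := by exact_mod_cast hn.ne'
    push_cast
    field_simp
  have h3 : (1 / 2 : ℂ) = ((1 / 2 : ℝ) : ℂ) := by push_cast; rfl
  rw [h2, h3, ← Complex.ofReal_cpow (by positivity), ← Real.sqrt_eq_rpow,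
    ofReal_mul √(2 * π / (γ * n)), ofReal_exp]
  congr 2
  have : (γ : ℂ) ≠ 0 := by exact_mod_cast hγ.ne'
  have : (n : ℂ) ≠ 0 := by exact_mod_cast hn.ne'
  push_cast
  field_simp
  ring

theorem exists_bound_mul_pow {ε : ℝ} (h0 : 0 ≤ ε) (h1 : ε < 1) :
    ∃ K : ℝ, ∀ n : ℕ, n * ε ^ n ≤ K := by
  obtain ⟨K, hK⟩ := (tendsto_self_mul_const_pow_of_lt_one h0 h1).bddAbove_range
  exact ⟨K, fun n => hK ⟨n, rfl⟩⟩

/-- Half of the exponential decay is traded for the polynomial factor; this reduces the cubic error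
to the linear one. -/
theorem mul_exp_neg_mul_le {a x : ℝ} (ha : 0 < a) :
    x * Real.exp (-(a * x)) ≤ 2 / a * Real.exp (-(a / 2 * x)) := by
  have h1 : a / 2 * x ≤ Real.exp (a / 2 * x) := by linarith [Real.add_one_le_exp (a / 2 * x)]
  have h2 : x ≤ 2 / a * Real.exp (a / 2 * x) := by
    rw [div_mul_eq_mul_div, le_div_iff₀ ha]; linarith
  calc x * Real.exp (-(a * x)) ≤ 2 / a * Real.exp (a / 2 * x) * Real.exp (-(a * x)) :=
        mul_le_mul_of_nonneg_right h2 (Real.exp_pos _).le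
    _ = _ := by rw [mul_assoc, ← Real.exp_add]; ring_nf

/-- A local limit theorem with speed of convergence from estimates of characteristic functions. -/
theorem local_limit_of_charFun {p : ℕ → ℕ → ℝ} {β γ c a ε C : ℝ} {N : ℕ} (hγ : 0 < γ) (hc : 0 < c)
    (hcπ : c ≤ π)     (ha : 0 < a) (hε0 : 0 ≤ ε) (hε1 : ε < 1) (hC : 0 ≤ C)
    (h1 : ∀ n, N ≤ n → ∀ θ : ℝ, |θ| ≤ c →
      ‖∑ k ∈ range (n + 1), (p n k : ℂ) * cexp (k * θ * I) - gaussianChar β γ n θ‖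
        ≤ C * ((|θ| + n * |θ| ^ 3) * Real.exp (-(a * n) * θ ^ 2) + ε ^ n))
    (h2 : ∀ n, N ≤ n → ∀ θ : ℝ, c ≤ |θ| → |θ| ≤ π →
      ‖∑ k ∈ range (n + 1), (p n k : ℂ) * cexp (k * θ * I)‖ ≤ C * ε ^ n) :
    ∃ (C' : ℝ) (N' : ℕ), ∀ n : ℕ, N' ≤ n → ∀ k : ℕ, k ≤ n →
      |√(n : ℝ) * p n k - Real.exp (-(((k : ℝ) - β * (n : ℝ)) ^ 2 / (2 * γ * (n : ℝ)))) /
        √(2 * π * γ)| ≤ C' * (n : ℝ) ^ (-(1 / 2) : ℝ) := by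
  obtain ⟨E, hE⟩ := exists_bound_mul_pow hε0 hε1
  -- One decay rate serves both errors: $a/2$ is what remains after absorbing $n\theta^2$, and
  -- $\gamma/2$ is the rate of the Gaussian itself.
  set δ := min (a / 2) (γ / 2) with hδ
  have hδ0 : 0 < δ := lt_min (by positivity) (by positivity)
  set K := C * (1 + 2 / a) + 1 / c with hK
  refine ⟨(K / δ + 2 * π * C * E) / (2 * π), max N 1, fun n hn k hk => ?_⟩
  have hnN : N ≤ n := (le_max_left _ _).trans hn
  have hn0 : 0 < n := (le_max_right _ _).trans hn
  have hn' : (0 : ℝ) < n := by exact_mod_cast hn0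
  set Ψ : ℝ → ℂ := fun θ => ∑ k ∈ range (n + 1), (p n k : ℂ) * cexp (k * θ * I) with hΨ
  have hexpk : ∀ θ : ℝ, ‖cexp (-(k * θ * I))‖ = 1 := fun θ => by
    have : -((k : ℂ) * θ * I) = ((-(k * θ) : ℝ) : ℂ) * I := by push_cast; ring
    rw [this, Complex.norm_exp_ofReal_mul_I]
  have hsmall : ∀ θ : ℝ, ∀ d, δ ≤ d → Real.exp (-(d * n) * θ ^ 2) ≤ Real.exp (-(δ * n) * θ ^ 2) := by
    intro θ d hd
    refine Real.exp_le_exp.2 ?_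
    have := mul_le_mul_of_nonneg_right hd (by positivity : 0 ≤ (n : ℝ) * θ ^ 2)
    linarith
  have hGsmall : ∀ θ : ℝ, c ≤ |θ| →
      ‖gaussianChar β γ n θ‖ ≤ 1 / c * (|θ| * Real.exp (-(δ * n) * θ ^ 2)) := by
    intro θ hθ
    rw [norm_gaussianChar, ← mul_assoc, one_div_mul_eq_div]
    exact (hsmall θ _ (min_le_right _ _)).trans
      (le_mul_of_one_le_left (Real.exp_pos _).le ((one_le_div hc).2 hθ))
  -- The characteristic function is cut off to one period but the Gaussian is integrated over the
  -- whole line. Its tail is harmless: there $|\theta|\ge c$, so a factor $|\theta|/c\ge 1$ can be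
  -- inserted.
  set F : ℝ → ℂ := fun θ => (Set.Ioc (-π) π).indicator (fun θ => Ψ θ * cexp (-(k * θ * I))) θ -
    gaussianChar β γ n θ * cexp (-(k * θ * I)) with hF
  set bnd : ℝ → ℝ := fun θ => K * (|θ| * Real.exp (-(δ * n) * θ ^ 2)) +
    (Set.Ioc (-π) π).indicator (fun _ => C * ε ^ n) θ with hbnd
  have hFb : ∀ θ, ‖F θ‖ ≤ bnd θ := by
    intro θ
    have hC1 : 0 ≤ C * (1 + 2 / a) := by positivity
    have hX : 0 ≤ |θ| * Real.exp (-(δ * n) * θ ^ 2) := by positivity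
    by_cases hθ : θ ∈ Set.Ioc (-π) π
    · have hFθ : ‖F θ‖ = ‖Ψ θ - gaussianChar β γ n θ‖ := by
        simp only [hF, Set.indicator_of_mem hθ]
        rw [← sub_mul, norm_mul, hexpk, mul_one]
      simp only [hbnd, Set.indicator_of_mem hθ]
      rw [hFθ, hK, add_mul]
      rcases le_total |θ| c with hθc | hθc
      · refine (h1 n hnN θ hθc).trans ?_
        have h3 : |θ| * Real.exp (-(a * n) * θ ^ 2) ≤ |θ| * Real.exp (-(δ * n) * θ ^ 2) :=
          mul_le_mul_of_nonneg_left (hsmall θ a ((min_le_left _ _).trans (by linarith)))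
            (abs_nonneg _)
        have h4 : n * |θ| ^ 3 * Real.exp (-(a * n) * θ ^ 2)
            ≤ 2 / a * (|θ| * Real.exp (-(δ * n) * θ ^ 2)) := by
          have h5 := mul_exp_neg_mul_le (x := n * θ ^ 2) ha
          have h6 := hsmall θ (a / 2) (min_le_left _ _)
          calc n * |θ| ^ 3 * Real.exp (-(a * n) * θ ^ 2)
              = |θ| * ((n * θ ^ 2) * Real.exp (-(a * (n * θ ^ 2)))) := by
                rw [← sq_abs]; ring_nf
            _ ≤ |θ| * (2 / a * Real.exp (-(a / 2 * (n * θ ^ 2)))) :=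
                mul_le_mul_of_nonneg_left h5 (abs_nonneg _)
            _ = 2 / a * (|θ| * Real.exp (-(a / 2 * n) * θ ^ 2)) := by ring_nf
            _ ≤ _ := by gcongr
        have h7 : C * ((|θ| + n * |θ| ^ 3) * Real.exp (-(a * n) * θ ^ 2) + ε ^ n) ≤
            C * ((1 + 2 / a) * (|θ| * Real.exp (-(δ * n) * θ ^ 2)) + ε ^ n) :=
          mul_le_mul_of_nonneg_left (by linarith) hC
        have h8 : 0 ≤ 1 / c * (|θ| * Real.exp (-(δ * n) * θ ^ 2)) := by positivity
        linarith
      · have hθπ : |θ| ≤ π := abs_le.2 ⟨hθ.1.le, hθ.2⟩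
        have h3 := h2 n hnN θ hθc hθπ
        have h4 := hGsmall θ hθc
        have h5 := norm_sub_le (Ψ θ) (gaussianChar β γ n θ)
        have h6 := mul_nonneg hC1 hX
        linarith
    · simp only [hF, hbnd, Set.indicator_of_notMem hθ, zero_sub, norm_neg, add_zero]
      rw [norm_mul, hexpk, mul_one, hK, add_mul]
      have h6 := mul_nonneg hC1 hX
      by_cases hθc : c ≤ |θ|
      · have := hGsmall θ hθc
        linarith
      · rw [not_le] at hθc
        have h7 := abs_lt.1 (hθc.trans_le hcπ)
        exact absurd ⟨h7.1, h7.2.le⟩ hθ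
  have hΨint : IntegrableOn (fun θ : ℝ => Ψ θ * cexp (-(k * θ * I))) (Set.Ioc (-π) π) := by
    refine Continuous.integrableOn_Ioc ?_
    simp only [hΨ]
    fun_prop
  have hFint : ∫ θ, F θ = 2 * π * p n k -
      ((√(2 * π / (γ * n)) * Real.exp (-((k - β * n) ^ 2 / (2 * γ * n))) : ℝ) : ℂ) := by
    simp only [hF]
    rw [integral_sub ((integrable_indicator_iff measurableSet_Ioc).2 hΨint)
      (integrable_gaussianChar_mul β hγ hn0 k), integral_indicator measurableSet_Ioc,
      ← intervalIntegral.integral_of_le (by linarith [Real.pi_pos]),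
      integral_charFun_mul_exp (p n) n k hk, integral_gaussianChar_mul β hγ hn0 k]
  have hδn : 0 < δ * n := by positivity
  have hcst : Integrable ((Set.Ioc (-π) π).indicator fun _ : ℝ => C * ε ^ n) :=
    (integrable_indicator_iff measurableSet_Ioc).2
      (integrableOn_const (by rw [Real.volume_Ioc]; exact ENNReal.ofReal_ne_top))
  have hmain : ‖∫ θ, F θ‖ ≤ (K / δ + 2 * π * C * E) / n := by
    refine (norm_integral_le_of_norm_le (((integrable_abs_mul_exp_neg_mul_sq hδn).const_mul K).add
      hcst) (Eventually.of_forall hFb)).trans ?_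
    simp only [Pi.add_apply]
    rw [integral_add ((integrable_abs_mul_exp_neg_mul_sq hδn).const_mul K) hcst,
      integral_const_mul, integral_abs_mul_exp_neg_mul_sq hδn, integral_indicator measurableSet_Ioc]
    simp only [integral_const, MeasurableSet.univ, measureReal_restrict_apply, Set.univ_inter,
      Real.volume_real_Ioc, smul_eq_mul]
    rw [max_eq_left (by linarith [Real.pi_pos]), le_div_iff₀ hn']
    have h3 := mul_le_mul_of_nonneg_left (hE n) (by positivity : 0 ≤ 2 * π * C)
    have h4 : K * (1 / (δ * n)) * n = K / δ := by field_simp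
    calc (K * (1 / (δ * n)) + (π - -π) * (C * ε ^ n)) * n
        = K * (1 / (δ * n)) * n + 2 * π * C * (n * ε ^ n) := by ring
      _ ≤ _ := by rw [h4]; linarith
  rw [hFint] at hmain
  have hmain' : |2 * π * p n k - √(2 * π / (γ * n)) *
      Real.exp (-((k - β * n) ^ 2 / (2 * γ * n)))| ≤ (K / δ + 2 * π * C * E) / n := by
    rw [← Real.norm_eq_abs, ← Complex.norm_real]
    push_cast
    push_cast at hmain
    exact hmain
  have hsq : √(n : ℝ) * √(2 * π / (γ * n)) = 2 * π / √(2 * π * γ) := by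
    rw [← Real.sqrt_mul hn'.le, eq_div_iff (by positivity), ← Real.sqrt_mul (by positivity)]
    have : (n : ℝ) * (2 * π / (γ * n)) * (2 * π * γ) = (2 * π) ^ 2 := by field_simp
    rw [this, Real.sqrt_sq (by positivity)]
  have hfin : √(n : ℝ) * p n k - Real.exp (-(((k : ℝ) - β * n) ^ 2 / (2 * γ * n))) / √(2 * π * γ)
      = √(n : ℝ) / (2 * π) * (2 * π * p n k - √(2 * π / (γ * n)) *
      Real.exp (-((k - β * n) ^ 2 / (2 * γ * n)))) := by
    have hπ := Real.pi_pos
    have h5 : √(n : ℝ) / (2 * π) * (√(2 * π / (γ * n)) *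
        Real.exp (-((k - β * n) ^ 2 / (2 * γ * n)))) =
        (√(n : ℝ) * √(2 * π / (γ * n))) / (2 * π) *
          Real.exp (-((k - β * n) ^ 2 / (2 * γ * n))) := by ring
    rw [mul_sub, h5, hsq]
    field_simp
  rw [hfin, abs_mul, abs_of_nonneg (by positivity)]
  refine (mul_le_mul_of_nonneg_left hmain' (by positivity)).trans (le_of_eq ?_)
  rw [Real.rpow_neg hn'.le, ← Real.sqrt_eq_rpow]
  have h6 : √(n : ℝ) * √(n : ℝ) = n := Real.mul_self_sqrt hn'.le
  have h7 : √(n : ℝ) ≠ 0 := by positivity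
  have hπ := Real.pi_pos
  rw [show (n : ℝ) = √(n : ℝ) * √(n : ℝ) from h6.symm, Real.sqrt_mul_self (by positivity)]
  field_simp

end LocalLimit

end SymbolStat

end

section

open Finset Complex Filter
open scoped Topology Real

namespace SymbolStat

/-! ### Quasi-powers compared with Gaussians -/

section QuasiPower

/-- Telescoping of the difference of powers; the factor `m` on the left avoids the exponent $n-1$.
-/
theorem norm_pow_sub_pow_le {x y : ℂ} {m : ℝ} (hx : ‖x‖ ≤ m) (hy : ‖y‖ ≤ m) (n : ℕ) :
    m * ‖x ^ n - y ^ n‖ ≤ n * ‖x - y‖ * m ^ n := by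
  have hm : 0 ≤ m := (norm_nonneg _).trans hx
  induction n with
  | zero => simp
  | succ n ih =>
    have h1 : x ^ (n + 1) - y ^ (n + 1) = x * (x ^ n - y ^ n) + (x - y) * y ^ n := by ring
    have h2 : ‖x ^ (n + 1) - y ^ (n + 1)‖ ≤ m * ‖x ^ n - y ^ n‖ + ‖x - y‖ * m ^ n := by
      rw [h1]
      refine (norm_add_le _ _).trans (add_le_add ?_ ?_)
      · rw [norm_mul]; exact mul_le_mul_of_nonneg_right hx (norm_nonneg _)
      · rw [norm_mul, norm_pow]
        exact mul_le_mul_of_nonneg_left (pow_le_pow_left₀ (norm_nonneg _) hy n) (norm_nonneg _)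
    calc m * ‖x ^ (n + 1) - y ^ (n + 1)‖
        ≤ m * (m * ‖x ^ n - y ^ n‖ + ‖x - y‖ * m ^ n) := mul_le_mul_of_nonneg_left h2 hm
      _ ≤ m * (n * ‖x - y‖ * m ^ n + ‖x - y‖ * m ^ n) := by gcongr
      _ = _ := by push_cast; ring

theorem AnalyticAt.isBigO_pow_three {f : ℂ → ℂ} (hf : AnalyticAt ℂ f 0) (h0 : f 0 = 0)
    (h1 : deriv f 0 = 0) (h2 : iteratedDeriv 2 f 0 = 0) :
    f =O[𝓝 0] fun z => ‖z‖ ^ 3 := by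
  have h := hf.hasFPowerSeriesAt.isBigO_sub_partialSum_pow 3
  simpa [FormalMultilinearSeries.partialSum, sum_range_succ, h0, h1, h2] using h

/-- An analytic function with prescribed derivatives of order at most two is approximated to third
order by a Gaussian exponential. -/
theorem isBigO_sub_gaussian {w : ℂ → ℂ} {β γ : ℂ} (hw : AnalyticAt ℂ w 0) (h0 : w 0 = 1)
    (h1 : deriv w 0 = β) (h2 : iteratedDeriv 2 w 0 = γ + β ^ 2) :
    (fun z => w z - cexp (β * z + γ / 2 * z ^ 2)) =O[𝓝 0] fun z => ‖z‖ ^ 3 := by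
  set g : ℂ → ℂ := fun z => cexp (β * z + γ / 2 * z ^ 2) with hg
  have hgd : ∀ z, HasDerivAt g ((β + γ * z) * g z) z := by
    intro z
    have h3 : HasDerivAt (fun z : ℂ => β * z + γ / 2 * z ^ 2) (β + γ * z) z := by
      have := ((hasDerivAt_id z).const_mul β).add ((hasDerivAt_pow 2 z).const_mul (γ / 2))
      refine this.congr_deriv ?_
      push_cast
      ring
    rw [mul_comm]
    exact h3.cexp
  have hg1 : deriv g = fun z => (β + γ * z) * g z := funext fun z => (hgd z).deriv
  have hg0 : g 0 = 1 := by simp [hg]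
  have hg2 : iteratedDeriv 2 g 0 = γ + β ^ 2 := by
    rw [iteratedDeriv_succ, iteratedDeriv_one, hg1]
    have h3 : HasDerivAt (fun z : ℂ => β + γ * z) γ 0 := by
      simpa using ((hasDerivAt_id (0 : ℂ)).const_mul γ).const_add β
    have := (h3.fun_mul (hgd 0)).deriv
    rw [this, hg0]
    ring
  have hga : AnalyticAt ℂ g 0 := by
    refine AnalyticAt.cexp ?_
    fun_prop
  refine AnalyticAt.isBigO_pow_three (hw.sub hga) ?_ ?_ ?_
  · simp [h0]
  · have := (hw.differentiableAt.hasDerivAt.fun_sub (hgd 0)).deriv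
    rw [this, h1, hg0]
    ring
  · have := iteratedDeriv_fun_sub (n := 2) (x := 0) (f := w) (g := g) hw.contDiffAt hga.contDiffAt
    rw [this, h2, hg2, sub_self]

theorem tendsto_ofReal_mul_I : Tendsto (fun θ : ℝ => (θ : ℂ) * I) (𝓝 0) (𝓝 0) := by
  have : Continuous fun θ : ℝ => (θ : ℂ) * I := by fun_prop
  simpa using this.tendsto 0

/-- Near $0$ both bases differ by $O(|\theta|^3)$ and have modulus at most $e^{-\gamma\theta^2/4}$,
so the telescoped difference of `n`-th powers keeps Gaussian decay. -/
theorem eventually_norm_pow_sub_gaussianChar_le {w : ℂ → ℂ} {β γ : ℝ} (hγ : 0 < γ)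
    (hw : AnalyticAt ℂ w 0) (h0 : w 0 = 1) (h1 : deriv w 0 = β)
    (h2 : iteratedDeriv 2 w 0 = γ + β ^ 2) :
    ∃ C : ℝ, 0 ≤ C ∧ ∀ᶠ θ : ℝ in 𝓝 0, ∀ n : ℕ,
      ‖w (θ * I) ^ n - gaussianChar β γ n θ‖ ≤
        C * (n * |θ| ^ 3 * Real.exp (-(γ / 4 * n) * θ ^ 2)) := by
  obtain ⟨K, hK0, hK⟩ := (isBigO_sub_gaussian hw h0 h1 h2).exists_nonneg
  have hK' := tendsto_ofReal_mul_I.eventually hK.bound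
  have hs1 : ∀ᶠ θ : ℝ in 𝓝 0, γ * θ ^ 2 < 1 := by
    have : Tendsto (fun θ : ℝ => γ * θ ^ 2) (𝓝 0) (𝓝 (γ * 0 ^ 2)) :=
      (Continuous.tendsto (by fun_prop) 0)
    exact this.eventually_lt_const (by simp)
  have hs2 : ∀ᶠ θ : ℝ in 𝓝 0, K * |θ| < γ / 8 := by
    have : Tendsto (fun θ : ℝ => K * |θ|) (𝓝 0) (𝓝 (K * |0|)) :=
      (Continuous.tendsto (by fun_prop) 0)
    exact this.eventually_lt_const (by simpa using hγ)
  refine ⟨K * Real.exp 1, by positivity, ?_⟩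
  filter_upwards [hK', hs1, hs2] with θ hθ hθ1 hθ2 n
  have hnorm : ‖(θ : ℂ) * I‖ = |θ| := by simp
  rw [hnorm, Real.norm_of_nonneg (by positivity)] at hθ
  set x := w (θ * I)
  set y := cexp (β * (θ * I) + γ / 2 * (θ * I) ^ 2) with hy
  -- The Gaussian base has modulus $e^{-2t}$. Asking only for $e^{-t}$ leaves slack at least $t/2$,
  -- which absorbs the cubic error.
  set t := γ / 4 * θ ^ 2 with ht
  have ht0 : 0 ≤ t := by positivity
  have ht1 : t ≤ 1 / 4 := by rw [ht]; linarith
  have hyn : ‖y‖ = Real.exp (-(2 * t)) := by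
    have := norm_gaussianChar β γ 1 θ
    simp only [gaussianChar, Nat.cast_one, one_mul] at this
    rw [hy, this, ht]
    ring_nf
  have hG : gaussianChar β γ n θ = y ^ n := by rw [gaussianChar, hy, ← Complex.exp_nat_mul]
  have hym : ‖y‖ ≤ Real.exp (-t) := by rw [hyn]; exact Real.exp_le_exp.2 (by linarith)
  have hxm : ‖x‖ ≤ Real.exp (-t) := by
    have h3 : ‖x‖ ≤ ‖y‖ + K * |θ| ^ 3 := by
      have := norm_sub_norm_le x y
      linarith
    have h4 : K * |θ| ^ 3 ≤ t / 2 := by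
      have h5 : K * |θ| ^ 3 = K * |θ| * θ ^ 2 := by rw [← sq_abs θ]; ring
      have h6 := mul_le_mul_of_nonneg_right hθ2.le (sq_nonneg θ)
      rw [h5, ht]
      linarith
    have h7 : Real.exp (-t) = Real.exp (-(2 * t)) * Real.exp t := by rw [← Real.exp_add]; ring_nf
    have h8 : 1 / 2 ≤ Real.exp (-(2 * t)) := by linarith [Real.add_one_le_exp (-(2 * t))]
    have h9 : t + 1 ≤ Real.exp t := Real.add_one_le_exp t
    have h10 : Real.exp (-(2 * t)) * (t + 1) ≤ Real.exp (-(2 * t)) * Real.exp t :=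
      mul_le_mul_of_nonneg_left h9 (Real.exp_pos _).le
    have h11 : 1 / 2 * t ≤ Real.exp (-(2 * t)) * t := mul_le_mul_of_nonneg_right h8 ht0
    rw [hyn] at h3
    linarith
  have hmain := norm_pow_sub_pow_le hxm hym n
  rw [hG]
  have hexp : Real.exp (-(γ / 4 * n) * θ ^ 2) = Real.exp (-t) ^ n := by
    rw [← Real.exp_nat_mul, ht]; ring_nf
  have hE : 1 ≤ Real.exp 1 * Real.exp (-t) := by
    rw [← Real.exp_add]; exact Real.one_le_exp (by linarith)
  rw [hexp]
  calc ‖x ^ n - y ^ n‖ ≤ Real.exp 1 * Real.exp (-t) * ‖x ^ n - y ^ n‖ :=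
        le_mul_of_one_le_left (norm_nonneg _) hE
    _ = Real.exp 1 * (Real.exp (-t) * ‖x ^ n - y ^ n‖) := by ring
    _ ≤ Real.exp 1 * (n * (K * |θ| ^ 3) * Real.exp (-t) ^ n) := by
        refine mul_le_mul_of_nonneg_left (hmain.trans ?_) (Real.exp_pos _).le
        gcongr
    _ = _ := by ring

/-- Local limit theorem for sequences whose characteristic functions behave as a quasi-power near
`0` and are exponentially small elsewhere. -/
theorem local_limit_of_quasiPower {p : ℕ → ℕ → ℝ} {H : ℕ → ℂ → ℂ} {w s : ℂ → ℂ} {β γ ε C : ℝ}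
    (hγ : 0 < γ)
    (hp : ∀ n, ∀ θ : ℝ, ∑ k ∈ range (n + 1), (p n k : ℂ) * cexp (k * θ * I) = H n (θ * I) / H n 0)
    (hw : AnalyticAt ℂ w 0) (h0 : w 0 = 1) (h1 : deriv w 0 = β)
    (h2 : iteratedDeriv 2 w 0 = γ + β ^ 2) (hs : AnalyticAt ℂ s 0) (hs0 : s 0 ≠ 0)
    (hε0 : 0 ≤ ε) (hε1 : ε < 1) (hC : 0 ≤ C)
    (hnear : ∀ᶠ z in 𝓝 (0 : ℂ), ∀ n : ℕ, ‖H n z - w z ^ n * s z‖ ≤ C * ε ^ n)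
    (hfar : ∀ c : ℝ, 0 < c → ∃ ρ D : ℝ, 0 ≤ ρ ∧ ρ < 1 ∧ 0 ≤ D ∧ ∀ θ : ℝ, c ≤ |θ| → |θ| ≤ π →
      ∀ n : ℕ, ‖H n (θ * I)‖ ≤ D * ρ ^ n) :
    ∃ (C' : ℝ) (N' : ℕ), ∀ n : ℕ, N' ≤ n → ∀ k : ℕ, k ≤ n →
      |√(n : ℝ) * p n k - Real.exp (-(((k : ℝ) - β * (n : ℝ)) ^ 2 / (2 * γ * (n : ℝ)))) /
        √(2 * π * γ)| ≤ C' * (n : ℝ) ^ (-(1 / 2) : ℝ) := by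
  obtain ⟨C₁, hC₁, hgauss⟩ := eventually_norm_pow_sub_gaussianChar_le hγ hw h0 h1 h2
  obtain ⟨L, hL0, hL⟩ := hs.differentiableAt.isBigO_sub.exists_nonneg
  have hL' := tendsto_ofReal_mul_I.eventually hL.bound
  have hsB : ∀ᶠ θ : ℝ in 𝓝 0, ‖s (θ * I)‖ < ‖s 0‖ + 1 :=
    tendsto_ofReal_mul_I.eventually
      (hs.continuousAt.norm.eventually_lt_const (lt_add_one _))
  obtain ⟨c₀, hc₀, hloc⟩ := Metric.eventually_nhds_iff.1
    (hgauss.and (hL'.and (hsB.and (tendsto_ofReal_mul_I.eventually hnear))))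
  set c := min (c₀ / 2) π with hcdef
  have hc : 0 < c := lt_min (by linarith) Real.pi_pos
  obtain ⟨ρ, D, hρ0, hρ1, hD, hfar⟩ := hfar c hc
  have hnear0 := hnear.self_of_nhds
  have htend : Tendsto (fun n => H n 0) atTop (𝓝 (s 0)) := by
    rw [tendsto_iff_norm_sub_tendsto_zero]
    refine squeeze_zero (fun n => norm_nonneg _) (fun n => ?_)
      (by simpa using (tendsto_pow_atTop_nhds_zero_of_lt_one hε0 hε1).const_mul C)
    simpa [h0] using hnear0 n
  set d := ‖s 0‖ / 2 with hd
  have hd0 : 0 < d := by have := norm_pos_iff.2 hs0; positivity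
  obtain ⟨N, hN⟩ := eventually_atTop.1
    (htend.norm.eventually_const_lt (show d < ‖s 0‖ by rw [hd]; linarith))
  set ε' := max ε ρ with hε'
  have hε'0 : 0 ≤ ε' := hε0.trans (le_max_left _ _)
  have hεn : ∀ n : ℕ, ε ^ n ≤ ε' ^ n := fun n => pow_le_pow_left₀ hε0 (le_max_left _ _) n
  have hρn : ∀ n : ℕ, ρ ^ n ≤ ε' ^ n := fun n => pow_le_pow_left₀ hρ0 (le_max_right _ _) n
  refine local_limit_of_charFun (c := c) (a := γ / 4) (ε := ε')
    (C := (C₁ * (‖s 0‖ + 1) + L + 2 * C + D) / d) (N := N) hγ hc (min_le_right _ _) (by positivity)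
    hε'0 (max_lt hε1 hρ1) (by positivity) (fun n hn θ hθ => ?_) (fun n hn θ hθ hθπ => ?_)
  · have hHd := hN n hn
    have hH0 : H n 0 ≠ 0 := norm_pos_iff.1 (hd0.trans hHd)
    obtain ⟨g1, g2, g3, g4⟩ := hloc (y := θ) (by
      rw [Real.dist_eq, sub_zero]
      exact lt_of_le_of_lt (hθ.trans (min_le_left _ _)) (by linarith))
    have g1 := g1 n
    have g4 := g4 n
    have g5 := hnear0 n
    rw [h0, one_pow, one_mul] at g5
    have hnorm : ‖(θ : ℂ) * I‖ = |θ| := by simp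
    rw [sub_zero, hnorm] at g2
    set E := Real.exp (-(γ / 4 * n) * θ ^ 2) with hE
    set G := gaussianChar β γ n θ with hGdef
    have hGE : ‖G‖ ≤ E := by
      rw [hGdef, norm_gaussianChar]
      refine Real.exp_le_exp.2 ?_
      have : 0 ≤ γ * (n * θ ^ 2) := by positivity
      linarith
    have hE1 : E ≤ 1 := Real.exp_le_one_iff.2 (by
      have : 0 ≤ γ * (n * θ ^ 2) := by positivity
      linarith)
    have hE0 : 0 < E := Real.exp_pos _
    rw [hp n θ]
    -- The errors are separated: powers of `w` against the Gaussian, $s(i\theta)$ against $s(0)$,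
    -- and the exponentially small remainders at $i\theta$ and at $0$.
    have hid : H n (θ * I) / H n 0 - G = ((w (θ * I) ^ n - G) * s (θ * I) + G * (s (θ * I) - s 0) +
        (H n (θ * I) - w (θ * I) ^ n * s (θ * I)) - G * (H n 0 - s 0)) / H n 0 := by
      field_simp
      ring
    rw [hid, norm_div, div_mul_eq_mul_div]
    refine div_le_div₀ (by positivity) ?_ hd0 hHd.le
    have b1 : ‖(w (θ * I) ^ n - G) * s (θ * I)‖ ≤ C₁ * (n * |θ| ^ 3 * E) * (‖s 0‖ + 1) := by
      rw [norm_mul]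
      exact mul_le_mul g1 g3.le (norm_nonneg _) (by positivity)
    have b2 : ‖G * (s (θ * I) - s 0)‖ ≤ E * (L * |θ|) := by
      rw [norm_mul]
      exact mul_le_mul hGE g2 (norm_nonneg _) hE0.le
    have b3 : ‖G * (H n 0 - s 0)‖ ≤ 1 * (C * ε ^ n) := by
      rw [norm_mul]
      exact mul_le_mul (hGE.trans hE1) g5 (norm_nonneg _) zero_le_one
    have b4 := norm_sub_le ((w (θ * I) ^ n - G) * s (θ * I) + G * (s (θ * I) - s 0) +
        (H n (θ * I) - w (θ * I) ^ n * s (θ * I))) (G * (H n 0 - s 0))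
    have b5 := norm_add₃_le (a := (w (θ * I) ^ n - G) * s (θ * I)) (b := G * (s (θ * I) - s 0))
      (c := H n (θ * I) - w (θ * I) ^ n * s (θ * I))
    have b6 := mul_le_mul_of_nonneg_left (hεn n) hC
    have hC₁' : 0 ≤ C₁ * (‖s 0‖ + 1) := by positivity
    have e1 : 0 ≤ |θ| * E := by positivity
    have e2 : 0 ≤ n * |θ| ^ 3 * E := by positivity
    have e3 : 0 ≤ ε' ^ n := pow_nonneg hε'0 n
    have f1 := mul_nonneg hC₁' e1
    have f2 := mul_nonneg hC₁' e3
    have f3 := mul_nonneg hL0 e2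
    have f4 := mul_nonneg hL0 e3
    have f5 := mul_nonneg hC e1
    have f6 := mul_nonneg hC e2
    have f7 := mul_nonneg hD (add_nonneg (add_nonneg e1 e2) e3)
    linarith
  · have hHd := hN n hn
    rw [hp n θ, norm_div, div_mul_eq_mul_div]
    refine div_le_div₀ (by positivity) ?_ hd0 hHd.le
    refine (hfar θ hθ hθπ n).trans ?_
    have := mul_le_mul_of_nonneg_left (hρn n) hD
    have : 0 ≤ (C₁ * (‖s 0‖ + 1) + L + 2 * C) * ε' ^ n := by positivity
    linarith

end QuasiPower

end SymbolStat

end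

section

open Matrix Finset Complex Filter
open scoped Topology Real ENNReal NNReal Matrix.Norms.Operator

namespace SymbolStat

/-! ### Eigenvalues of entrywise dominated matrices -/

section Domination

variable {ι : Type*} [Fintype ι] [DecidableEq ι]

theorem pow_mul_norm_le_of_dominated {M : Matrix ι ι ℝ} {T : Matrix ι ι ℂ}
    (hT : ∀ i j, ‖T i j‖ ≤ M i j) {w : ι → ℂ} {μ : ℂ} (hw : T *ᵥ w = μ • w) (n : ℕ) (i : ι) :
    ‖μ‖ ^ n * ‖w i‖ ≤ (M ^ n *ᵥ fun i => ‖w i‖) i := by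
  induction n generalizing i with
  | zero => simp
  | succ n ih =>
    have h1 : ∑ j, T i j * w j = μ * w i := congrFun hw i
    rw [pow_succ, pow_succ M, mul_assoc, ← norm_mul, ← h1, pow_mul_comm', ← mulVec_mulVec]
    calc ‖μ‖ ^ n * ‖∑ j, T i j * w j‖ ≤ ‖μ‖ ^ n * ∑ j, M i j * ‖w j‖ := by
          refine mul_le_mul_of_nonneg_left ((norm_sum_le _ _).trans (sum_le_sum fun j _ => ?_))
            (by positivity)
          rw [norm_mul]
          exact mul_le_mul_of_nonneg_right (hT i j) (norm_nonneg _)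
      _ = ∑ j, M i j * (‖μ‖ ^ n * ‖w j‖) := by
          rw [mul_sum]
          exact sum_congr rfl fun j _ => by ring
      _ ≤ ∑ j, M i j * (M ^ n *ᵥ fun i => ‖w i‖) j :=
          sum_le_sum fun j _ => mul_le_mul_of_nonneg_left (ih j) ((norm_nonneg _).trans (hT i j))

/-- Here `M` need not be primitive, so no Perron vectors are used: $|\mu|^n|w|\le M^n|w|$ entrywise,
and $\|M^n\|\le C\rho^n$ excludes $|\mu|>\rho$. -/
theorem norm_eigenvalue_le_of_dominated {M : Matrix ι ι ℝ} {T : Matrix ι ι ℂ}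
    (hT : ∀ i j, ‖T i j‖ ≤ M i j) {w : ι → ℂ} (hw0 : w ≠ 0) {μ : ℂ} (hw : T *ᵥ w = μ • w)
    {ρ : ℝ≥0} (hρ : spectralRadius ℂ (M.map (fun x : ℝ => (x : ℂ))) < ρ) : ‖μ‖ ≤ ρ := by
  obtain ⟨C, hC0, hC⟩ := eventually_norm_pow_le (X := Unit)
    (S := fun _ => M.map (fun x : ℝ => (x : ℂ))) (x₀ := ()) continuousAt_const hρ
  have hC := hC.self_of_nhds
  have hρ0 : 0 < (ρ : ℝ) := by
    have : (0 : ℝ≥0∞) < ρ := lt_of_le_of_lt zero_le hρ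
    exact_mod_cast this
  obtain ⟨i, hi⟩ := Function.ne_iff.1 hw0
  have hi' : 0 < ‖w i‖ := norm_pos_iff.2 hi
  by_contra! hlt
  set W : ι → ℂ := fun i => ((‖w i‖ : ℝ) : ℂ) with hW
  have hb : ∀ n : ℕ, (‖μ‖ / ρ) ^ n ≤ C * ‖W‖ / ‖w i‖ := by
    intro n
    have h1 := pow_mul_norm_le_of_dominated hT hw n i
    have h2 : (((M ^ n *ᵥ fun i => ‖w i‖) i : ℝ) : ℂ)
        = ((M.map (fun x : ℝ => (x : ℂ))) ^ n *ᵥ W) i := by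
      have : (M.map (fun x : ℝ => (x : ℂ))) ^ n = (M ^ n).map (fun x : ℝ => (x : ℂ)) :=
        (Matrix.map_pow M n (f := Complex.ofRealHom)).symm
      rw [this]
      simp [mulVec, dotProduct, hW]
    have h3 : (M ^ n *ᵥ fun i => ‖w i‖) i ≤ C * (ρ : ℝ) ^ n * ‖W‖ := by
      calc (M ^ n *ᵥ fun i => ‖w i‖) i ≤ ‖(((M ^ n *ᵥ fun i => ‖w i‖) i : ℝ) : ℂ)‖ := by
            rw [Complex.norm_real]; exact le_abs_self _
        _ ≤ ‖(M.map (fun x : ℝ => (x : ℂ))) ^ n *ᵥ W‖ := by rw [h2]; exact norm_le_pi_norm _ i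
        _ ≤ ‖(M.map (fun x : ℝ => (x : ℂ))) ^ n‖ * ‖W‖ := linfty_opNorm_mulVec _ _
        _ ≤ C * (ρ : ℝ) ^ n * ‖W‖ := mul_le_mul_of_nonneg_right (hC n) (norm_nonneg _)
    rw [div_pow, div_le_div_iff₀ (by positivity) hi']
    linarith
  obtain ⟨n, hn⟩ := pow_unbounded_of_one_lt (C * ‖W‖ / ‖w i‖) ((one_lt_div hρ0).2 hlt)
  exact absurd (hb n) (not_le.2 hn)

end Domination

namespace LinRep

/-! ### Generating functions and characteristic functions of the letter count -/

section Fourier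

variable {ι : Type} [Fintype ι] [DecidableEq ι] (R : LinRep ι)

/-- The complex generating function `ξ' (A e^z + B)^n η`. -/
noncomputable def genFun (n : ℕ) (z : ℂ) : ℂ :=
  (fun i => (R.ξ i : ℂ)) ⬝ᵥ (R.expMatrix z ^ n *ᵥ fun i => (R.η i : ℂ))

/-- Expanding the `n`-th power of $Ae^z+B$ by distributivity yields one term per word; the induction
peels off the first letter. -/
theorem sum_exp_countA_smul_morphism (n : ℕ) (z : ℂ) :
    ∑ w : Fin n → Letter, cexp (z * countA w) •
      (R.morphism (word w)).map (fun x : ℝ => (x : ℂ)) = R.expMatrix z ^ n := by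
  induction n with
  | zero =>
    rw [Fintype.sum_unique, pow_zero]
    have : (word (default : Fin 0 → Letter)) = 1 := by simp [word]
    rw [this, map_one]
    have h1 : (1 : Matrix ι ι ℝ).map (fun x : ℝ => (x : ℂ)) = 1 :=
      Matrix.map_one _ Complex.ofReal_zero Complex.ofReal_one
    rw [h1]
    simp [countA]
  | succ n ih =>
    rw [← Equiv.sum_comp (Fin.consEquiv fun _ : Fin (n + 1) => Letter), Fintype.sum_prod_type]
    have hof : ∀ (c : Letter) (w : Fin n → Letter),
        List.ofFn (Fin.consEquiv (fun _ : Fin (n + 1) => Letter) (c, w)) = c :: List.ofFn w := by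
      intro c w
      rw [List.ofFn_succ]
      rfl
    have hword : ∀ (c : Letter) (w : Fin n → Letter),
        word (Fin.consEquiv (fun _ : Fin (n + 1) => Letter) (c, w)) = FreeMonoid.of c * word w := by
      intro c w
      rw [word, hof, FreeMonoid.ofList_cons, word]
    have hcount : ∀ (c : Letter) (w : Fin n → Letter),
        countA (Fin.consEquiv (fun _ : Fin (n + 1) => Letter) (c, w)) =
          countA w + if c = Letter.a then 1 else 0 := by
      intro c w
      rw [countA, hof, List.count_cons, countA]
      cases c <;> simp
    have hterm : ∀ (c : Letter) (w : Fin n → Letter),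
        cexp (z * countA (Fin.consEquiv (fun _ : Fin (n + 1) => Letter) (c, w))) •
          (R.morphism (word (Fin.consEquiv (fun _ : Fin (n + 1) => Letter) (c, w)))).map
            (fun x : ℝ => (x : ℂ)) =
        (cexp (z * (if c = Letter.a then 1 else 0)) • (R.letterMatrix c).map
          (fun x : ℝ => (x : ℂ))) * (cexp (z * countA w) •
            (R.morphism (word w)).map (fun x : ℝ => (x : ℂ))) := by
      intro c w
      have h1 : (R.letterMatrix c * R.morphism (word w)).map (fun x : ℝ => (x : ℂ)) =
          (R.letterMatrix c).map (fun x : ℝ => (x : ℂ)) *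
            (R.morphism (word w)).map (fun x : ℝ => (x : ℂ)) :=
        Matrix.map_mul (f := Complex.ofRealHom)
      have h2 : R.morphism (FreeMonoid.of c) = R.letterMatrix c := by simp [morphism]
      rw [hword, hcount, map_mul, h2, h1, smul_mul_assoc, mul_smul_comm, smul_smul,
        ← Complex.exp_add]
      congr 2
      push_cast
      ring
    simp only [hterm, ← mul_sum, ih]
    rw [← sum_mul, pow_succ']
    congr 1
    have : (univ : Finset Letter) = {Letter.a, Letter.b} := rfl
    rw [this, sum_pair (by decide)]
    simp [expMatrix, letterMatrix]

theorem sum_series_mul_exp (n : ℕ) (z : ℂ) :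
    ∑ w : Fin n → Letter, (R.series (word w) : ℂ) * cexp (z * countA w) = R.genFun n z := by
  rw [genFun, ← sum_exp_countA_smul_morphism, sum_mulVec, dotProduct_sum]
  refine sum_congr rfl fun w _ => ?_
  rw [smul_mulVec, dotProduct_smul, smul_eq_mul, mul_comm]
  congr 1
  simp [series, dotProduct, mulVec]

theorem sum_probY_mul_exp (n : ℕ) (θ : ℝ) :
    ∑ k ∈ range (n + 1), (R.probY n k : ℂ) * cexp (k * θ * I) =
      R.genFun n (θ * I) / R.genFun n 0 := by
  have hZ : ((∑ x : Fin n → Letter, R.series (word x) : ℝ) : ℂ) = R.genFun n 0 := by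
    rw [← sum_series_mul_exp]
    push_cast
    exact sum_congr rfl fun w _ => by simp
  have hmaps : ∀ w ∈ (univ : Finset (Fin n → Letter)), countA w ∈ range (n + 1) := by
    intro w _
    have : countA w ≤ (List.ofFn w).length := List.count_le_length
    rw [List.length_ofFn] at this
    exact mem_range.2 (by omega)
  rw [← sum_series_mul_exp, ← hZ, sum_div, ← sum_fiberwise_of_maps_to hmaps]
  refine sum_congr rfl fun k _ => ?_
  rw [probY]
  push_cast
  rw [sum_mul]
  refine sum_congr rfl fun w hw => ?_
  rw [(mem_filter.1 hw).2, probWord]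
  push_cast
  rw [show (θ : ℂ) * I * k = k * θ * I by ring]
  ring

end Fourier

/-! ### Local limit theorem for a representation with a spectral gap -/

section Uniform

variable {ι : Type} [Fintype ι] [DecidableEq ι] [Nonempty ι] (R : LinRep ι)

/-- Each $\theta$ in the compact annulus has a neighbourhood with a common geometric bound; finitely
many suffice, and the maxima of their rates and constants work throughout. -/
theorem exists_uniform_bound {r : ℝ} (hr : 0 < r)
    (hgap : ∀ θ : ℝ, θ ≠ 0 → |θ| ≤ π → ∀ μ : ℂ, ∀ w : ι → ℂ, w ≠ 0 →
      R.expMatrix (θ * I) *ᵥ w = μ • w → ‖μ‖ < r) {c : ℝ} (hc : 0 < c) :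
    ∃ ρ C : ℝ, 0 ≤ ρ ∧ ρ < r ∧ 0 ≤ C ∧ ∀ θ : ℝ, c ≤ |θ| → |θ| ≤ π →
      ∀ n : ℕ, ‖R.expMatrix (θ * I) ^ n‖ ≤ C * ρ ^ n := by
  have hcont : Continuous fun θ : ℝ => R.expMatrix (θ * I) := by
    refine continuous_matrix fun i j => ?_
    simp only [expMatrix_apply]
    fun_prop
  have hcomp : IsCompact {θ : ℝ | c ≤ |θ| ∧ |θ| ≤ π} := by
    refine (isCompact_Icc (a := -π) (b := π)).of_isClosed_subset ?_ fun θ hθ => abs_le.1 hθ.2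
    exact (isClosed_le continuous_const continuous_abs).inter
      (isClosed_le continuous_abs continuous_const)
  have := hcomp.induction_on (p := fun s => ∃ ρ C : ℝ, 0 ≤ ρ ∧ ρ < r ∧ 0 ≤ C ∧ ∀ θ ∈ s,
      ∀ n : ℕ, ‖R.expMatrix (θ * I) ^ n‖ ≤ C * ρ ^ n) ?_ ?_ ?_ ?_
  · obtain ⟨ρ, C, h1, h2, h3, h4⟩ := this
    exact ⟨ρ, C, h1, h2, h3, fun θ hθ hθ' => h4 θ ⟨hθ, hθ'⟩⟩
  · exact ⟨0, 0, le_rfl, hr, le_rfl, fun θ hθ => hθ.elim⟩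
  · rintro s t hst ⟨ρ, C, h1, h2, h3, h4⟩
    exact ⟨ρ, C, h1, h2, h3, fun θ hθ => h4 θ (hst hθ)⟩
  · rintro s t ⟨ρ, C, h1, h2, h3, h4⟩ ⟨ρ', C', h1', h2', h3', h4'⟩
    refine ⟨max ρ ρ', max C C', h1.trans (le_max_left _ _), max_lt h2 h2',
      h3.trans (le_max_left _ _), fun θ hθ n => ?_⟩
    rcases hθ with hθ | hθ
    · exact (h4 θ hθ n).trans (mul_le_mul (le_max_left _ _)
        (pow_le_pow_left₀ h1 (le_max_left _ _) n) (by positivity) (h3.trans (le_max_left _ _)))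
    · exact (h4' θ hθ n).trans (mul_le_mul (le_max_right _ _)
        (pow_le_pow_left₀ h1' (le_max_right _ _) n) (by positivity) (h3.trans (le_max_left _ _)))
  · rintro θ ⟨hθ, hθπ⟩
    have hθ0 : θ ≠ 0 := by
      rintro rfl
      rw [abs_zero] at hθ
      linarith
    obtain ⟨ρ, hρ0, hρr, hρ⟩ := spectralRadius_lt_of_eigenvalues (hgap θ hθ0 hθπ)
    obtain ⟨C, hC0, hC⟩ := eventually_norm_pow_le (S := fun θ : ℝ => R.expMatrix (θ * I))
      hcont.continuousAt hρ
    exact ⟨_, mem_nhdsWithin_of_mem_nhds hC, ρ, C, ρ.2, hρr, hC0, fun θ hθ => hθ⟩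

/-- Local limit theorem for a linear representation whose dominant eigenvalue is simple, isolated,
and strictly larger than the eigenvalues of the twisted matrices. -/
theorem local_limit {u : ℂ → ℂ} {r β γ : ℝ} (hr : 0 < r) (hγ : 0 < γ) (hu : AnalyticAt ℂ u 0)
    (hu0 : u 0 = r) (hβ : deriv u 0 / r = β) (hγ' : iteratedDeriv 2 u 0 / r = γ + β ^ 2)
    (hroot : ∀ᶠ z in 𝓝 (0 : ℂ), (R.expMatrix z).charpoly.IsRoot (u z))
    (hsimple : (R.expMatrix 0).charpoly.derivative.eval (r : ℂ) ≠ 0)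
    (hgap0 : ∀ μ : ℂ, ∀ w : ι → ℂ, w ≠ 0 → R.expMatrix 0 *ᵥ w = μ • w → μ = r ∨ ‖μ‖ < r)
    (hgap : ∀ θ : ℝ, θ ≠ 0 → |θ| ≤ π → ∀ μ : ℂ, ∀ w : ι → ℂ, w ≠ 0 →
      R.expMatrix (θ * I) *ᵥ w = μ • w → ‖μ‖ < r)
    (hpos : ∃ d : ℝ, 0 < d ∧ ∃ᶠ n : ℕ in atTop, d * r ^ n ≤ ‖R.genFun n 0‖) :
    ∃ (C' : ℝ) (N' : ℕ), ∀ n : ℕ, N' ≤ n → ∀ k : ℕ, k ≤ n →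
      |√(n : ℝ) * R.probY n k - Real.exp (-(((k : ℝ) - β * (n : ℝ)) ^ 2 / (2 * γ * (n : ℝ)))) /
        √(2 * π * γ)| ≤ C' * (n : ℝ) ^ (-(1 / 2) : ℝ) := by
  have hrc : (r : ℂ) ≠ 0 := by exact_mod_cast hr.ne'
  have hnu0 : ‖u 0‖ = r := by rw [hu0, Complex.norm_real, Real.norm_of_nonneg hr.le]
  obtain ⟨P, hP, -, -, ρ, C, hρ0, hρr, hC0, hPb⟩ := exists_spectral_splitting (T := R.expMatrix)
    (u := u) (R.analyticAt_expMatrix 0) (fun i j => R.analyticAt_expMatrix_apply 0 i j) hu hroot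
    (by rwa [hu0]) (by rwa [hu0]) (by rw [hu0, Complex.norm_real, Real.norm_of_nonneg hr.le]; exact hgap0)
  rw [hnu0] at hρr
  let ev' : Matrix ι ι ℂ →ₗ[ℂ] ℂ :=
    { toFun := fun Q => (fun i => (R.ξ i : ℂ)) ⬝ᵥ (Q *ᵥ fun i => (R.η i : ℂ))
      map_add' := fun Q Q' => by rw [add_mulVec, dotProduct_add]
      map_smul' := fun c Q => by rw [smul_mulVec, dotProduct_smul]; rfl }
  set ev := ev'.toContinuousLinearMap with hev
  set B : ℝ := (∑ i, ‖(R.ξ i : ℂ)‖) * ‖fun i => (R.η i : ℂ)‖ with hB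
  have hB0 : 0 ≤ B := by positivity
  have hevB : ∀ Q : Matrix ι ι ℂ, ‖ev Q‖ ≤ B * ‖Q‖ := by
    intro Q
    change ‖∑ i, (R.ξ i : ℂ) * (Q *ᵥ fun i => (R.η i : ℂ)) i‖ ≤ _
    rw [hB, mul_assoc, sum_mul]
    refine (norm_sum_le _ _).trans (sum_le_sum fun i _ => ?_)
    rw [norm_mul]
    refine mul_le_mul_of_nonneg_left ((norm_le_pi_norm _ i).trans ?_) (norm_nonneg _)
    rw [mul_comm]
    exact linfty_opNorm_mulVec _ _
  have hgen : ∀ n z, R.genFun n z = ev (R.expMatrix z ^ n) := fun n z => rfl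
  set s : ℂ → ℂ := fun z => ev (P z) with hs
  have hs_an : AnalyticAt ℂ s 0 := (ev.analyticAt _).comp hP
  have hnear : ∀ᶠ z in 𝓝 (0 : ℂ), ∀ n : ℕ,
      ‖R.genFun n z / r ^ n - (u z * (r : ℂ)⁻¹) ^ n * s z‖ ≤ B * C * (ρ / r) ^ n := by
    filter_upwards [hPb] with z hz n
    have h1 : R.genFun n z / r ^ n - (u z * (r : ℂ)⁻¹) ^ n * s z =
        ev (R.expMatrix z ^ n - u z ^ n • P z) / r ^ n := by
      rw [hgen, map_sub, map_smul, smul_eq_mul, mul_pow, inv_pow]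
      simp only [hs]
      field_simp
    rw [h1, norm_div, norm_pow, Complex.norm_real, Real.norm_of_nonneg hr.le, div_pow,
      ← mul_div_assoc]
    refine div_le_div_of_nonneg_right ((hevB _).trans ?_) (by positivity)
    rw [mul_assoc B C]
    exact mul_le_mul_of_nonneg_left (hz n) hB0
  have hε1 : ρ / r < 1 := (div_lt_one hr).2 hρr
  have hε0 : 0 ≤ ρ / r := by positivity
  -- If $s(0)$ vanished, the normalized generating function at $0$ would decay exponentially,
  -- contradicting its lower bound along infinitely many `n`.
  have hs0 : s 0 ≠ 0 := by
    intro h0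
    obtain ⟨d, hd, hfreq⟩ := hpos
    have h1 := hnear.self_of_nhds
    have h2 : Tendsto (fun n : ℕ => B * C * (ρ / r) ^ n) atTop (𝓝 0) := by
      simpa using (tendsto_pow_atTop_nhds_zero_of_lt_one hε0 hε1).const_mul (B * C)
    obtain ⟨n, hn1, hn2⟩ := (hfreq.and_eventually (h2.eventually_lt_const hd)).exists
    have h3 := h1 n
    rw [h0, mul_zero, sub_zero, norm_div, norm_pow, Complex.norm_real,
      Real.norm_of_nonneg hr.le] at h3
    have h4 : d ≤ ‖R.genFun n 0‖ / r ^ n := (le_div_iff₀ (by positivity)).2 hn1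
    linarith
  refine local_limit_of_quasiPower (H := fun n z => R.genFun n z / r ^ n)
    (w := fun z => u z * (r : ℂ)⁻¹) (s := s) hγ (fun n θ => ?_) (hu.mul analyticAt_const) ?_ ?_ ?_
    hs_an hs0 hε0 hε1 (by positivity) hnear (fun c hc => ?_)
  · rw [sum_probY_mul_exp]
    have : (r : ℂ) ^ n ≠ 0 := pow_ne_zero _ hrc
    rw [div_div_div_cancel_right₀ this]
  · rw [hu0, mul_inv_cancel₀ hrc]
  · rw [deriv_mul_const_field, ← div_eq_mul_inv, hβ]
  · rw [iteratedDeriv_mul_const_field, ← div_eq_mul_inv, hγ']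
  · obtain ⟨ρ', D, h1, h2, h3, h4⟩ := R.exists_uniform_bound hr hgap hc
    refine ⟨ρ' / r, B * D, by positivity, (div_lt_one hr).2 h2, by positivity,
      fun θ hθ hθπ n => ?_⟩
    rw [hgen, norm_div, norm_pow, Complex.norm_real, Real.norm_of_nonneg hr.le, div_pow,
      ← mul_div_assoc]
    refine div_le_div_of_nonneg_right ((hevB _).trans ?_) (by positivity)
    rw [mul_assoc B D]
    exact mul_le_mul_of_nonneg_left (h4 θ hθ hθπ n) hB0

end Uniform

end LinRep

end SymbolStat

end

section

open Matrix Finset Complex Filter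
open scoped Topology Real ENNReal NNReal Matrix.Norms.Operator

namespace SymbolStat

/-! ### Aperiodicity and the spectral gap off the origin -/

theorem smul_eq_one_of_convex {a b : ℝ} (ha : 0 ≤ a) (hb : 0 ≤ b) {x y : ℂ} (hx : ‖x‖ = 1)
    (hy : ‖y‖ = 1) (h : (a : ℂ) * x + b * y = a + b) : (0 < a → x = 1) ∧ (0 < b → y = 1) := by
  have hx1 : x.re ≤ 1 := hx ▸ Complex.re_le_norm x
  have hy1 : y.re ≤ 1 := hy ▸ Complex.re_le_norm y
  have hre : a * x.re + b * y.re = a + b := by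
    have := congrArg Complex.re h
    simpa using this
  have h1 := mul_nonneg ha (sub_nonneg.2 hx1)
  have h2 := mul_nonneg hb (sub_nonneg.2 hy1)
  have key : ∀ z : ℂ, ‖z‖ = 1 → z.re = 1 → z = 1 := fun z hz hz' => by
    have := PerronTriple.eq_of_norm_le_of_re_eq (m := 1) hz.le hz'
    simpa using this
  refine ⟨fun ha' => key x hx ?_, fun hb' => key y hy ?_⟩
  · have : a * (1 - x.re) = 0 := by linarith
    have := (mul_eq_zero.1 this).resolve_left ha'.ne'
    linarith
  · have : b * (1 - y.re) = 0 := by linarith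
    have := (mul_eq_zero.1 this).resolve_left hb'.ne'
    linarith

namespace LinRep

theorem IsWalk.phase {ι : Type} {R : LinRep ι} {s : ι → ℂ} {κ ζ : ℂ}
    (hA : ∀ i j, 0 < R.A i j → ζ * s j = κ * s i)
    (hB : ∀ i j, 0 < R.B i j → s j = κ * s i) {i j : ι} {w : List Letter}
    (hw : R.IsWalk i j w) : ζ ^ w.count Letter.a * s j = κ ^ w.length * s i := by
  induction hw with
  | nil i => simp
  | @cons i j k w c hc p ih =>
    cases c with
    | a =>
      have := hA i j hc
      rw [List.count_cons_self, List.length_cons, pow_succ', mul_assoc, ih, pow_succ, mul_assoc,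
        ← this]
      ring
    | b =>
      have := hB i j hc
      rw [List.count_cons_of_ne (by decide), List.length_cons, ih, pow_succ, mul_assoc, ← this]

/-- The order of $\zeta$ divides every cycle difference, hence their gcd, which is $1$. -/
theorem IsAperiodic.eq_one {ι : Type} {R : LinRep ι} (haper : R.IsAperiodic) {ζ : ℂ}
    (hζ : ζ ≠ 0) (h : ∀ (i j : ι) (u v : List Letter), R.IsWalk i i u → R.IsWalk j j v →
      u.length = v.length → ζ ^ u.count Letter.a = ζ ^ v.count Letter.a) : ζ = 1 := by
  have hdvd : orderOf ζ ∣ Nat.setGcd R.cycleDifferences := by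
    refine Nat.dvd_setGcd_iff.2 ?_
    rintro d ⟨i, j, u, v, hu, hv, hlen, rfl⟩
    rw [orderOf_dvd_iff_pow_eq_one]
    have h1 := h i j u v hu hv hlen
    have hz : ζ ^ ((u.count Letter.a : ℤ) - (v.count Letter.a : ℤ)) = 1 := by
      rw [zpow_sub₀ hζ, zpow_natCast, zpow_natCast, h1, div_self (pow_ne_zero _ hζ)]
    rcases Int.natAbs_eq ((u.count Letter.a : ℤ) - (v.count Letter.a : ℤ)) with h2 | h2
    · rw [h2, zpow_natCast] at hz
      exact hz
    · rw [h2, _root_.zpow_neg, zpow_natCast, inv_eq_one] at hz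
      exact hz
  rw [haper, Nat.dvd_one, orderOf_eq_one_iff] at hdvd
  exact hdvd

section

variable {ι : Type} [Fintype ι] [DecidableEq ι] {R : LinRep ι}

theorem norm_expMatrix_le (θ : ℝ) (i j : ι) : ‖R.expMatrix (θ * I) i j‖ ≤ R.M i j := by
  rw [expMatrix_apply]
  refine (norm_add_le _ _).trans (le_of_eq ?_)
  rw [norm_mul, Complex.norm_exp_ofReal_mul_I, Complex.norm_real, Complex.norm_real,
    Real.norm_of_nonneg (R.A_nonneg i j), Real.norm_of_nonneg (R.B_nonneg i j), one_mul]
  rfl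

/-- If the modulus were `r`, the phases of the eigenvector would give $\zeta^{|u|_a}=\kappa^{|u|}$
on every cycle, with $\zeta=e^{i\theta}$. Aperiodicity then forces $\zeta=1$, impossible for
$0<|\theta|\le\pi$. -/
theorem norm_eigenvalue_expMatrix_lt [Nonempty ι] {r : ℝ} {v l : ι → ℝ}
    (h : PerronTriple R.M r v l) (hM : R.M.IsPrimitive) (haper : R.IsAperiodic) {θ : ℝ}
    (hθ0 : θ ≠ 0) (hθ : |θ| ≤ π) {μ : ℂ} {w : ι → ℂ} (hw0 : w ≠ 0)
    (hw : R.expMatrix (θ * I) *ᵥ w = μ • w) : ‖μ‖ < r := by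
  refine lt_of_le_of_ne (h.norm_eigenvalue_le (norm_expMatrix_le θ) hw0 hw) fun hμ => ?_
  have hphase := h.phase_eq hM (norm_expMatrix_le θ) hw0 hμ hw
  obtain ⟨hwpos, -⟩ := h.abs_eigenvector hM (norm_expMatrix_le θ) hw0 hμ.ge hw
  set s : ι → ℂ := fun i => w i / ‖w i‖ with hs
  set κ : ℂ := μ / r with hκ
  set ζ : ℂ := cexp (θ * I) with hζ
  have hs1 : ∀ i, ‖s i‖ = 1 := fun i => by simp [hs, (hwpos i).ne']
  have hs0 : ∀ i, s i ≠ 0 := fun i => norm_pos_iff.1 (by rw [hs1]; exact one_pos)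
  have hκ1 : ‖κ‖ = 1 := by simp [hκ, hμ, abs_of_pos h.r_pos, h.r_pos.ne']
  have hκ0 : κ ≠ 0 := norm_pos_iff.1 (by rw [hκ1]; exact one_pos)
  have hζ1 : ‖ζ‖ = 1 := Complex.norm_exp_ofReal_mul_I θ
  have hedge : ∀ i j, (0 < R.A i j → ζ * s j = κ * s i) ∧ (0 < R.B i j → s j = κ * s i) := by
    intro i j
    have h1 : R.expMatrix (θ * I) i j * s j = R.M i j * (κ * s i) := hphase i j
    have hd : κ * s i ≠ 0 := mul_ne_zero hκ0 (hs0 i)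
    have hM' : (R.M i j : ℂ) = R.A i j + R.B i j := by simp [M]
    rw [expMatrix_apply, ← hζ, hM'] at h1
    have h2 : (R.A i j : ℂ) * (ζ * s j / (κ * s i)) + R.B i j * (s j / (κ * s i))
        = R.A i j + R.B i j := by
      have h3 : (R.A i j : ℂ) * (ζ * s j / (κ * s i)) + R.B i j * (s j / (κ * s i))
          = (ζ * R.A i j + R.B i j) * s j / (κ * s i) := by ring
      rw [h3, h1, mul_div_assoc, div_self hd, mul_one]
    -- An edge may carry both letters, so the phase relation concerns a weighted sum; it attains its
    -- maximal value only if each phase with positive weight equals $1$.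
    obtain ⟨h3, h4⟩ := smul_eq_one_of_convex (R.A_nonneg i j) (R.B_nonneg i j)
      (by rw [norm_div, norm_mul, norm_mul, hζ1, hκ1, hs1, hs1]; norm_num)
      (by rw [norm_div, norm_mul, hκ1, hs1, hs1]; norm_num) h2
    exact ⟨fun hA => (div_eq_one_iff_eq hd).1 (h3 hA), fun hB => (div_eq_one_iff_eq hd).1 (h4 hB)⟩
  have hcycle : ∀ (i : ι) (u : List Letter), R.IsWalk i i u →
      ζ ^ u.count Letter.a = κ ^ u.length := fun i u hu =>
    mul_right_cancel₀ (hs0 i) (hu.phase (fun i j => (hedge i j).1) (fun i j => (hedge i j).2))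
  have hone : ζ = 1 := haper.eq_one (Complex.exp_ne_zero _) fun i j u v hu hv hlen => by
    rw [hcycle i u hu, hcycle j v hv, hlen]
  obtain ⟨n, hn⟩ := Complex.exp_eq_one_iff.1 hone
  have hn' : θ = n * (2 * π) := by
    have h1 : (θ : ℂ) * I = (n * (2 * π)) * I := by rw [hn]; ring
    have h2 := mul_right_cancel₀ I_ne_zero h1
    exact_mod_cast h2
  have hn0 : n ≠ 0 := by
    rintro rfl
    simp at hn'
    exact hθ0 hn'
  have habs : (1 : ℝ) ≤ |(n : ℝ)| := by exact_mod_cast Int.one_le_abs hn0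
  rw [hn', abs_mul, abs_of_pos (by positivity : (0 : ℝ) < 2 * π)] at hθ
  nlinarith [Real.pi_pos]

theorem norm_eigenvalue_expMatrix_le_of_perron_lt [Nonempty ι] {r : ℝ} (hr : R.perron < r) {θ : ℝ}
    {μ : ℂ} {w : ι → ℂ} (hw0 : w ≠ 0) (hw : R.expMatrix (θ * I) *ᵥ w = μ • w) : ‖μ‖ < r := by
  have hfin : spectralRadius ℂ (R.M.map (fun x : ℝ => (x : ℂ))) ≠ ⊤ :=
    ((spectrum.spectralRadius_le_nnnorm _).trans_lt ENNReal.coe_lt_top).ne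
  have hlt : spectralRadius ℂ (R.M.map (fun x : ℝ => (x : ℂ))) < ENNReal.ofReal r := by
    rw [← ENNReal.ofReal_toReal hfin]
    exact (ENNReal.ofReal_lt_ofReal_iff (lt_of_le_of_lt ENNReal.toReal_nonneg hr)).2 hr
  obtain ⟨ρ, h1, h2⟩ := ENNReal.lt_iff_exists_nnreal_btwn.1 hlt
  have h3 := norm_eigenvalue_le_of_dominated (norm_expMatrix_le θ) hw0 hw h1
  refine h3.trans_lt ?_
  rw [ENNReal.ofReal, ENNReal.coe_lt_coe] at h2
  exact Real.lt_toNNReal_iff_coe_lt.1 h2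

end

/-! ### Block triangular representations: spectrum and growth -/

section Bicomponent

theorem pow_entry_nonneg {ι : Type*} [Fintype ι] [DecidableEq ι] {M : Matrix ι ι ℝ}
    (hM : ∀ i j, 0 ≤ M i j) (n : ℕ) (i j : ι) : 0 ≤ (M ^ n) i j :=
  Matrix.pow_apply_nonneg hM n i j

theorem mul_entry_le_mul {ι : Type*} [Fintype ι] {M N : Matrix ι ι ℝ}
    (hM : ∀ i j, 0 ≤ M i j) (hN : ∀ i j, 0 ≤ N i j) (i j k : ι) :
    M i j * N j k ≤ (M * N) i k :=
  single_le_sum (f := fun j => M i j * N j k) (fun j _ => mul_nonneg (hM i j) (hN j k))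
    (mem_univ j)

/-- A row of a positive power $M^K$ dominates a positive multiple of `l`, and $lM^n=r^nl$. -/
theorem exists_pow_entry_lower_bound {ι : Type*} [Fintype ι] [DecidableEq ι] {M : Matrix ι ι ℝ}
    {r : ℝ} {v l : ι → ℝ} (h : PerronTriple M r v l) (hM : M.IsPrimitive) (i j : ι) :
    ∃ (δ : ℝ) (K : ℕ), 0 < δ ∧ ∀ n : ℕ, δ * r ^ n ≤ (M ^ (K + n)) i j := by
  obtain ⟨K, hK, hpos⟩ := hM.exists_pos_pow
  obtain ⟨s₀, -, hs₀⟩ := exists_min_image univ (fun s => (M ^ K) i s / l s) ⟨i, mem_univ i⟩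
  set d := (M ^ K) i s₀ / l s₀
  have hd : 0 < d := div_pos (hpos i s₀) (h.l_pos s₀)
  refine ⟨d * l j, K, mul_pos hd (h.l_pos j), fun n => ?_⟩
  have h1 : ∑ s, l s * (M ^ n) s j = r ^ n * l j := congrFun (vecMul_pow_eq h.vecMul_eq n) j
  rw [pow_add, Matrix.mul_apply]
  calc d * l j * r ^ n = ∑ s, d * l s * (M ^ n) s j := by
        rw [mul_assoc, mul_comm (l j), ← h1, mul_sum]
        exact sum_congr rfl fun s _ => by ring
    _ ≤ _ := sum_le_sum fun s _ => mul_le_mul_of_nonneg_right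
        ((le_div_iff₀ (h.l_pos s)).1 (hs₀ s (mem_univ s))) (pow_entry_nonneg hM.nonneg n s j)

variable {ι₁ ι₂ : Type} [Fintype ι₁] [DecidableEq ι₁] [Fintype ι₂] [DecidableEq ι₂]

theorem fromBlocks_pow_inl {P : Matrix ι₁ ι₁ ℝ} {Q : Matrix ι₁ ι₂ ℝ} {S : Matrix ι₂ ι₂ ℝ} (n : ℕ)
    (i j : ι₁) : (fromBlocks P Q 0 S ^ n) (Sum.inl i) (Sum.inl j) = (P ^ n) i j := by
  induction n generalizing j with
  | zero => simp [Matrix.one_apply]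
  | succ n ih =>
    rw [pow_succ, pow_succ, Matrix.mul_apply, Matrix.mul_apply, Fintype.sum_sum_type]
    simp [ih]

theorem fromBlocks_pow_inr {P : Matrix ι₁ ι₁ ℝ} {Q : Matrix ι₁ ι₂ ℝ} {S : Matrix ι₂ ι₂ ℝ} (n : ℕ)
    (i j : ι₂) : (fromBlocks P Q 0 S ^ n) (Sum.inr i) (Sum.inr j) = (S ^ n) i j := by
  induction n generalizing i with
  | zero => simp [Matrix.one_apply]
  | succ n ih =>
    rw [pow_succ', pow_succ', Matrix.mul_apply, Matrix.mul_apply, Fintype.sum_sum_type]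
    simp [ih]

variable {R₁ : LinRep ι₁} {R₂ : LinRep ι₂} {A₀ B₀ : Matrix ι₁ ι₂ ℝ}
  {hA₀ : ∀ i j, 0 ≤ A₀ i j} {hB₀ : ∀ i j, 0 ≤ B₀ i j}

theorem bicomponent_M : (bicomponent R₁ R₂ A₀ B₀ hA₀ hB₀).M =
    fromBlocks R₁.M (A₀ + B₀) 0 R₂.M := by
  simp [bicomponent, M, fromBlocks_add]

theorem charpoly_expMatrix_bicomponent (z : ℂ) :
    ((bicomponent R₁ R₂ A₀ B₀ hA₀ hB₀).expMatrix z).charpoly =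
      (R₁.expMatrix z).charpoly * (R₂.expMatrix z).charpoly := by
  have : (bicomponent R₁ R₂ A₀ B₀ hA₀ hB₀).expMatrix z = fromBlocks (R₁.expMatrix z)
      (cexp z • A₀.map (fun x : ℝ => (x : ℂ)) + B₀.map (fun x : ℝ => (x : ℂ))) 0
      (R₂.expMatrix z) := by
    ext (i | i) (j | j) <;> simp [expMatrix_apply, bicomponent]
  rw [this, charpoly_fromBlocks_zero₂₁]

theorem M_nonneg {ι : Type} (R : LinRep ι) (i j : ι) : 0 ≤ R.M i j :=
  add_nonneg (R.A_nonneg i j) (R.B_nonneg i j)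

theorem genFun_zero {ι : Type} [Fintype ι] [DecidableEq ι] (R : LinRep ι) (n : ℕ) :
    R.genFun n 0 = ((R.ξ ⬝ᵥ (R.M ^ n *ᵥ R.η) : ℝ) : ℂ) := by
  have : (R.M.map (fun x : ℝ => (x : ℂ))) ^ n = (R.M ^ n).map (fun x : ℝ => (x : ℂ)) :=
    (Matrix.map_pow R.M n (f := Complex.ofRealHom)).symm
  rw [genFun, expMatrix_zero, this]
  simp [dotProduct, mulVec]

theorem le_norm_genFun_zero {ι : Type} [Fintype ι] [DecidableEq ι] (R : LinRep ι) (n : ℕ)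
    (i j : ι) : R.ξ i * ((R.M ^ n) i j * R.η j) ≤ ‖R.genFun n 0‖ := by
  rw [genFun_zero, Complex.norm_real]
  refine le_trans ?_ (le_abs_self _)
  have h1 : ∀ i j, 0 ≤ (R.M ^ n) i j * R.η j := fun i j =>
    mul_nonneg (pow_entry_nonneg R.M_nonneg n i j) (R.η_nonneg j)
  refine (mul_le_mul_of_nonneg_left ?_ (R.ξ_nonneg i)).trans
    (single_le_sum (f := fun i => R.ξ i * (R.M ^ n *ᵥ R.η) i)
      (fun i _ => mul_nonneg (R.ξ_nonneg i) (sum_nonneg fun j _ => h1 i j)) (mem_univ i))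
  exact single_le_sum (f := fun j => (R.M ^ n) i j * R.η j) (fun j _ => h1 i j) (mem_univ j)

/-- Consider only paths that start in the support of $\xi_1$, stay in the first component for all
but a bounded number of steps, cross once, and take a fixed number `j` of steps to the support of
$\eta_2$. All other paths contribute nonnegatively. -/
theorem exists_frequently_le_norm_genFun_bicomponent {r : ℝ} {v l : ι₁ → ℝ}
    (h : PerronTriple R₁.M r v l) (hM₁ : R₁.M.IsPrimitive) (hM₂ : R₂.M.IsIrreducible)
    (hξ₁ : R₁.ξ ≠ 0) (hη₂ : R₂.η ≠ 0) (hM₀ : A₀ + B₀ ≠ 0) :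
    ∃ d : ℝ, 0 < d ∧ ∃ᶠ n : ℕ in atTop,
      d * r ^ n ≤ ‖(bicomponent R₁ R₂ A₀ B₀ hA₀ hB₀).genFun n 0‖ := by
  set R := bicomponent R₁ R₂ A₀ B₀ hA₀ hB₀ with hR
  obtain ⟨i₀, hi₀⟩ := Function.ne_iff.1 hξ₁
  obtain ⟨k₀, hk₀⟩ := Function.ne_iff.1 hη₂
  have hξpos : 0 < R₁.ξ i₀ := lt_of_le_of_ne (R₁.ξ_nonneg i₀) (Ne.symm hi₀)
  have hηpos : 0 < R₂.η k₀ := lt_of_le_of_ne (R₂.η_nonneg k₀) (Ne.symm hk₀)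
  obtain ⟨i₁, k₁, hik⟩ : ∃ i k, 0 < (A₀ + B₀) i k := by
    by_contra! hcon
    refine hM₀ (Matrix.ext fun i k => le_antisymm (hcon i k) ?_)
    exact add_nonneg (hA₀ i k) (hB₀ i k)
  obtain ⟨j, -, hj⟩ := (isIrreducible_iff_exists_pow_pos hM₂.nonneg).1 hM₂ k₁ k₀
  obtain ⟨δ, K, hδ, hbound⟩ := exists_pow_entry_lower_bound h hM₁ i₀ i₁
  have hr := h.r_pos
  set e := R₁.ξ i₀ * ((A₀ + B₀) i₁ k₁ * (R₂.M ^ j) k₁ k₀ * R₂.η k₀) with he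
  have he0 : 0 < e := by positivity
  refine ⟨δ * e / r ^ (K + (1 + j)), by positivity, ?_⟩
  refine frequently_atTop.2 fun N => ⟨K + N + (1 + j), by omega, ?_⟩
  have hRM : R.M = fromBlocks R₁.M (A₀ + B₀) 0 R₂.M := bicomponent_M
  have hentry : (R₁.M ^ (K + N)) i₀ i₁ * ((A₀ + B₀) i₁ k₁ * (R₂.M ^ j) k₁ k₀) ≤
      (R.M ^ (K + N + (1 + j))) (Sum.inl i₀) (Sum.inr k₀) := by
    have h1 := mul_entry_le_mul (pow_entry_nonneg R.M_nonneg (K + N))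
      (pow_entry_nonneg R.M_nonneg (1 + j)) (Sum.inl i₀) (Sum.inl i₁) (Sum.inr k₀)
    have h2 := mul_entry_le_mul (pow_entry_nonneg R.M_nonneg 1)
      (pow_entry_nonneg R.M_nonneg j) (Sum.inl i₁) (Sum.inr k₁) (Sum.inr k₀)
    rw [← pow_add] at h1 h2
    refine le_trans ?_ (le_trans (mul_le_mul_of_nonneg_left h2
      (pow_entry_nonneg R.M_nonneg (K + N) _ _)) h1)
    rw [hRM, fromBlocks_pow_inl, fromBlocks_pow_inr, pow_one, fromBlocks_apply₁₂]
  refine le_trans ?_ (R.le_norm_genFun_zero _ (Sum.inl i₀) (Sum.inr k₀))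
  have hξ : R.ξ (Sum.inl i₀) = R₁.ξ i₀ := rfl
  have hη : R.η (Sum.inr k₀) = R₂.η k₀ := rfl
  rw [hξ, hη]
  have h3 : δ * e / r ^ (K + (1 + j)) * r ^ (K + N + (1 + j)) = δ * r ^ N * e := by
    rw [show K + N + (1 + j) = K + (1 + j) + N by ring, pow_add r (K + (1 + j)) N]
    field_simp
  rw [h3]
  calc δ * r ^ N * e ≤ (R₁.M ^ (K + N)) i₀ i₁ * e := mul_le_mul_of_nonneg_right (hbound N) he0.le
    _ = R₁.ξ i₀ * ((R₁.M ^ (K + N)) i₀ i₁ * ((A₀ + B₀) i₁ k₁ * (R₂.M ^ j) k₁ k₀) * R₂.η k₀) := by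
        rw [he]; ring
    _ ≤ _ := by gcongr

end Bicomponent

end LinRep

end SymbolStat

end

/-! ### Assembly of the theorem -/

open SymbolStat SymbolStat.LinRep

theorem mainTheorem2 (m₁ m₂ : ℕ)
    (R₁ : SymbolStat.LinRep (Fin m₁)) (R₂ : SymbolStat.LinRep (Fin m₂))
    (A₀ B₀ : Matrix (Fin m₁) (Fin m₂) ℝ)
    (hA₀ : ∀ i j, 0 ≤ A₀ i j) (hB₀ : ∀ i j, 0 ≤ B₀ i j)
    -- the standing assumption that the random words exist
    (hadm : (SymbolStat.LinRep.bicomponent R₁ R₂ A₀ B₀ hA₀ hB₀).IsAdmissible)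
    -- two irreducible components that communicate
    (hM₁ : R₁.M.IsIrreducible) (hM₂ : R₂.M.IsIrreducible)
    (hξ₁ : R₁.ξ ≠ 0) (hη₂ : R₂.η ≠ 0) (hM₀ : A₀ + B₀ ≠ 0)
    -- the first component is dominant
    (hdom : R₂.perron < R₁.perron) (hprim : R₁.M.IsPrimitive)
    (haper : R₁.IsAperiodic) :
    -- the parameters of the first component are well defined
    R₁.IsImplicitRoot R₁.implicitRoot ∧
    ∃ β₁ γ₁ : ℝ, R₁.beta = (β₁ : ℂ) ∧ R₁.gamma = (γ₁ : ℂ) ∧ 0 < γ₁ ∧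
      ∃ (C : ℝ) (N : ℕ), ∀ n : ℕ, N ≤ n → ∀ k : ℕ, k ≤ n →
        |√(n : ℝ) * (SymbolStat.LinRep.bicomponent R₁ R₂ A₀ B₀ hA₀ hB₀).probY n k -
            Real.exp (-(((k : ℝ) - β₁ * (n : ℝ)) ^ 2 / (2 * γ₁ * (n : ℝ)))) /
              √(2 * Real.pi * γ₁)| ≤ C * (n : ℝ) ^ (-(1 / 2) : ℝ) := by
  have hne₁ : Nonempty (Fin m₁) := ⟨(Function.ne_iff.1 hξ₁).choose⟩
  have hne₂ : Nonempty (Fin m₂) := ⟨(Function.ne_iff.1 hη₂).choose⟩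
  obtain ⟨r, v, l, h⟩ := exists_perronTriple hprim
  have hperron : R₁.perron = r := perron_eq h hprim
  have hu := isImplicitRoot_implicitRoot hprim
  obtain ⟨β, γ, hβ, hγ, hγpos⟩ := exists_parameters hprim haper
  refine ⟨hu, β, γ, hβ, hγ, hγpos, ?_⟩
  have hu0 : R₁.implicitRoot 0 = (r : ℂ) := by rw [hu.map_zero, hperron]
  rw [hperron] at hdom
  rw [beta, hperron] at hβ
  rw [gamma, hperron, hβ] at hγ
  -- Writing $0$ as $0\cdot i$ lets the bound for the twisted second block also cover the untwisted
  -- one.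
  have hexp0 : ∀ {ι : Type} [Fintype ι] [DecidableEq ι] (R : LinRep ι),
      R.expMatrix 0 = R.expMatrix ((0 : ℝ) * Complex.I) := fun R => by simp
  have hsplit : ∀ (z μ : ℂ) (w : Fin m₁ ⊕ Fin m₂ → ℂ), w ≠ 0 →
      ((bicomponent R₁ R₂ A₀ B₀ hA₀ hB₀).expMatrix z).mulVec w = μ • w →
      (∃ w' ≠ 0, (R₁.expMatrix z).mulVec w' = μ • w') ∨ (∃ w' ≠ 0, (R₂.expMatrix z).mulVec w' = μ • w') := by
    intro z μ w hw0 hw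
    have h1 := isRoot_charpoly_iff.2 ⟨w, hw0, hw⟩
    rw [charpoly_expMatrix_bicomponent, Polynomial.root_mul] at h1
    exact h1.imp isRoot_charpoly_iff.1 isRoot_charpoly_iff.1
  refine local_limit (u := R₁.implicitRoot) (r := r) _ h.r_pos hγpos hu.analytic hu0 hβ
    (by linear_combination hγ) ?_ ?_ ?_ ?_
    (exists_frequently_le_norm_genFun_bicomponent h hprim hM₂ hξ₁ hη₂ hM₀)
  · filter_upwards [hu.eventually_isRoot] with z hz
    rw [charpoly_expMatrix_bicomponent]
    exact Polynomial.root_mul_right_of_isRoot _ hz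
  · have hr1 : (R₁.expMatrix 0).charpoly.eval (r : ℂ) = 0 := by
      have := hu.eventually_isRoot.self_of_nhds
      rwa [hu0] at this
    -- At `r` the product rule leaves $\chi_1'(r)\chi_2(r)$. The first factor is nonzero by
    -- simplicity, the second because `r` exceeds the spectral radius of the second block.
    rw [charpoly_expMatrix_bicomponent, Polynomial.derivative_mul, Polynomial.eval_add,
      Polynomial.eval_mul, Polynomial.eval_mul, hr1, zero_mul, add_zero]
    refine mul_ne_zero ?_ fun h2 => ?_
    · rw [expMatrix_zero]
      exact h.derivative_charpoly_ne_zero hprim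
    · obtain ⟨w, hw0, hw⟩ := isRoot_charpoly_iff.1 h2
      rw [hexp0] at hw
      have := norm_eigenvalue_expMatrix_le_of_perron_lt hdom hw0 hw
      rw [Complex.norm_real, Real.norm_of_nonneg h.r_pos.le] at this
      exact lt_irrefl _ this
  · intro μ w hw0 hw
    rcases hsplit 0 μ w hw0 hw with ⟨w', hw0', hw'⟩ | ⟨w', hw0', hw'⟩
    · rw [expMatrix_zero] at hw'
      exact h.eigenvalue_eq_or_lt hprim hw0' hw'
    · rw [hexp0] at hw'
      exact Or.inr (norm_eigenvalue_expMatrix_le_of_perron_lt hdom hw0' hw')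
  · intro θ hθ0 hθ μ w hw0 hw
    rcases hsplit _ μ w hw0 hw with ⟨w', hw0', hw'⟩ | ⟨w', hw0', hw'⟩
    · exact norm_eigenvalue_expMatrix_lt h hprim haper hθ0 hθ hw0' hw'
    · exact norm_eigenvalue_expMatrix_le_of_perron_lt hdom hw0' hw'
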